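/- Let $k$ be a commutative artinian ring, $R$ an artin $k$-algebra (a $k$-algebra finitely generated as a $k$-module), and $\mathrm{mod}\,R$ the category of finitely generated right $R$-modules. Let $D=\mathrm{Hom}_k(-,E)$, where $E$ is an injective envelope of $k/\mathrm{rad}\,k$. A pair $(\mathcal B,\mathcal A)$ of full subcategories of $\mathrm{mod}\,R$ is a *cotorsion pair* if $\mathcal B=\{X\in\mathrm{mod}\,R\mid \mathrm{Ext}^1_R(X,A)=0\ \forall A\in\mathcal A\}$ and $\mathcal A=\{Y\in\mathrm{mod}\,R\mid \mathrm{Ext}^1_R(B,Y)=0\ \forall B\in\mathcal B\}$. It is *hereditary* if $\mathcal B$ is resolving, i.e. contains all finitely generated projective modules and is closed under extensions, kernels of epimorphisms and direct summands. Let ${}_ST_R$ be a Wakamatsu-tilting bimodule: an $S$-$R$-bimodule, with $S$ a $k$-algebra and $k$ acting centrally, such that $T_R$ is finitely generated, the canonical maps $S\to\mathrm{End}(T_R)$ and $R\to\mathrm{End}({}_ST)$ are bijective, and $\mathrm{Ext}^i_R(T,T)=0=\mathrm{Ext}^i_S(T,T)$ for all $i>0$. Let $(\mathcal B,\mathcal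 A)$ be a hereditary cotorsion pair in $\mathrm{mod}\,R$, and assume that $T$ is an Ext-projective generator of $\mathcal A$: $T\in\mathcal A$, $\mathrm{Ext}^1_R(T,A)=0$ for all $A\in\mathcal A$, and every $A\in\mathcal A$ admits an exact sequence $0\to A'\to T_A\to A\to 0$ with $A'\in\mathcal A$ and $T_A$ a direct summand of a finite direct sum of copies of $T$. Let $\mathcal G=\mathrm{Hom}_R(T,\mathcal A)$ and $\mathcal K=\mathcal B\otimes_R DT$ be the classes of right $S$-modules isomorphic to $\mathrm{Hom}_R(T,A)$ with $A\in\mathcal A$, respectively to $B\otimes_R DT$ with $B\in\mathcal B$. Then $(\mathcal G,\mathcal K)$ is a hereditary cotorsion pair in $\mathrm{mod}\,S$, the category of finitely generated right $S$-modules. Moreover, the bimodules ${}_ST_R$ and ${}_RDT_S$ represent a cotorsion pair counter equivalence between $(\mathcal B,\mathcal A)$ and $(\mathcal G,\mathcal K)$, that is, the functors $$\mathrm{Hom}_R(T,-):\mathcal A\rightleftarrows\mathcal G:-\otimes_ST\qquad\text{and}\qquad \mathrm{Hom}_S(DT,-):\mathcal K\rightleftarrows\mathcal B:-\otimes_RDT$$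 are two pairs of mutually quasi-inverse equivalences. -/

import Mathlib

open CategoryTheory MulOpposite
open scoped TensorProduct

universe u

namespace CounterEquivalence

section InjectiveEnvelope

/-- The linear map `i : M → E` exhibits `E` as an injective envelope of `M`: `E` is injective and
`i` is an essential monomorphism. -/
structure IsInjectiveEnvelope {Λ : Type u} [Ring Λ] {M E : Type u} [AddCommGroup M] [Module Λ M]
    [AddCommGroup E] [Module Λ E] (i : M →ₗ[Λ] E) : Prop where
  injective_module : Module.Injective Λ E
  injective_map : Function.Injective i
  essential : ∀ N : Submodule Λ E, N ⊓ LinearMap.range i = ⊥ → N = ⊥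

theorem exists_injective_embedding (Λ : Type u) [Ring Λ] (M : Type u) [AddCommGroup M]
    [Module Λ M] : ∃ (I : Type u) (_ : AddCommGroup I) (_ : Module Λ I) (j : M →ₗ[Λ] I),
      Module.Injective Λ I ∧ Function.Injective j := by
  let X := ModuleCat.of Λ M
  refine ⟨(Injective.under X : ModuleCat Λ), inferInstance, inferInstance,
    (Injective.ι X).hom, ?_, ?_⟩
  · have h : Injective (ModuleCat.of Λ (Injective.under X : ModuleCat Λ)) :=
      inferInstanceAs (Injective (Injective.under X))
    exact Module.injective_module_of_injective_object Λ _
  · exact (ModuleCat.mono_iff_injective _).1 inferInstance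

/-- Every module has an injective envelope. -/
theorem exists_injectiveEnvelope (Λ : Type u) [Ring Λ] (M : Type u) [AddCommGroup M]
    [Module Λ M] : ∃ (E : Type u) (_ : AddCommGroup E) (_ : Module Λ E) (i : M →ₗ[Λ] E),
      IsInjectiveEnvelope i := by
  obtain ⟨I, _, _, j, hI, hj⟩ := exists_injective_embedding Λ M
  set M' : Submodule Λ I := LinearMap.range j with hM'
  -- a maximal essential extension of the image of `M` inside `I`
  obtain ⟨N, hMN, hN⟩ := zorn_le_nonempty₀
    {N : Submodule Λ I | M' ≤ N ∧ ∀ L ≤ N, L ⊓ M' = ⊥ → L = ⊥} (by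
      intro c hc hchain y hy
      refine ⟨sSup c, ⟨(hc hy).1.trans (le_sSup hy), ?_⟩, fun z hz => le_sSup hz⟩
      intro L hL hLM
      rw [eq_bot_iff]
      intro x hx
      obtain ⟨P, hPc, hxP⟩ :=
        (Submodule.mem_sSup_of_directed ⟨y, hy⟩ hchain.directedOn).1 (hL hx)
      have h1 : Submodule.span Λ {x} = ⊥ := by
        refine (hc hPc).2 _ ((Submodule.span_singleton_le_iff_mem x P).2 hxP) ?_
        rw [eq_bot_iff, ← hLM]
        exact inf_le_inf_right _ ((Submodule.span_singleton_le_iff_mem x L).2 hx)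
      exact (Submodule.mem_bot Λ).2 (Submodule.span_singleton_eq_bot.1 h1)) M'
    ⟨le_rfl, fun L hL h => by rwa [inf_eq_left.2 hL] at h⟩
  have hNess := hN.prop.2
  -- a maximal submodule meeting `N` trivially
  obtain ⟨C, -, hC⟩ := zorn_le_nonempty₀ {C : Submodule Λ I | C ⊓ N = ⊥} (by
      intro c hc hchain y hy
      refine ⟨sSup c, ?_, fun z hz => le_sSup hz⟩
      change sSup c ⊓ N = ⊥
      rw [eq_bot_iff]
      rintro x ⟨hx, hxN⟩
      obtain ⟨P, hPc, hxP⟩ :=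
        (Submodule.mem_sSup_of_directed ⟨y, hy⟩ hchain.directedOn).1 hx
      have : P ⊓ N = ⊥ := hc hPc
      rw [← this]
      exact ⟨hxP, hxN⟩) (⊥ : Submodule Λ I)
    (bot_inf_eq N)
  have hCN : C ⊓ N = ⊥ := hC.prop
  -- submodules of `I ⧸ C` that meet the image of `N` trivially vanish
  have hess : ∀ L : Submodule Λ (I ⧸ C), L.comap C.mkQ ⊓ N = ⊥ → L = ⊥ := by
    intro L hL
    have h1 : L.comap C.mkQ ≤ C := hC.le_of_ge hL (fun x hx => by
      rw [Submodule.mem_comap, Submodule.mkQ_apply, (Submodule.Quotient.mk_eq_zero C).2 hx]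
      exact L.zero_mem)
    rw [eq_bot_iff]
    intro x hx
    obtain ⟨y, rfl⟩ := C.mkQ_surjective x
    exact (Submodule.mem_bot Λ).2 ((Submodule.Quotient.mk_eq_zero C).2 (h1 hx))
  have hinj : Function.Injective (C.mkQ ∘ₗ N.subtype) := by
    rw [← LinearMap.ker_eq_bot, eq_bot_iff]
    intro x hx
    have h1 : (x : I) ∈ C := (Submodule.Quotient.mk_eq_zero C).1 hx
    have h2 : (x : I) ∈ C ⊓ N := ⟨h1, x.2⟩
    rw [hCN] at h2
    exact (Submodule.mem_bot Λ).2 (Subtype.ext ((Submodule.mem_bot Λ).1 h2))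
  obtain ⟨g, hg⟩ := hI.out (C.mkQ ∘ₗ N.subtype) hinj N.subtype
  have hg' : ∀ x ∈ N, g (C.mkQ x) = x := fun x hx => hg ⟨x, hx⟩
  have hNg : N ≤ LinearMap.range g := fun x hx => ⟨C.mkQ x, hg' x hx⟩
  have hgN : LinearMap.range g ≤ N := by
    refine hN.le_of_ge ⟨hMN.trans hNg, ?_⟩ hNg
    intro L hL hLM
    have h1 : L ⊓ N = ⊥ := hNess _ inf_le_right (by
      rw [eq_bot_iff, ← hLM]
      exact inf_le_inf_right _ inf_le_left)
    have h2 : L.comap g = ⊥ := hess _ (by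
      rw [eq_bot_iff, ← h1]
      rintro x ⟨hx, hxN⟩
      refine ⟨?_, hxN⟩
      have h3 : g (C.mkQ x) ∈ L := hx
      rwa [hg' x hxN] at h3)
    rw [eq_bot_iff]
    intro x hx
    obtain ⟨y, rfl⟩ := hL hx
    have h3 : y ∈ L.comap g := hx
    rw [h2] at h3
    rw [(Submodule.mem_bot Λ).1 h3, map_zero]
    exact Submodule.zero_mem _
  let r : I →ₗ[Λ] N := (g ∘ₗ C.mkQ).codRestrict N (fun x => hgN ⟨C.mkQ x, rfl⟩)
  have hr : ∀ x : N, r x = x := fun x => Subtype.ext (hg' x x.2)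
  refine ⟨N, inferInstance, inferInstance, j.codRestrict N (fun x => hMN ⟨x, rfl⟩), ?_, ?_, ?_⟩
  · constructor
    intro X Y _ _ _ _ f hf φ
    obtain ⟨h, hh⟩ := hI.out f hf (N.subtype ∘ₗ φ)
    refine ⟨r ∘ₗ h, fun x => ?_⟩
    rw [LinearMap.comp_apply, hh x]
    exact hr _
  · intro x y hxy
    exact hj (congrArg Subtype.val hxy)
  · intro L hL
    have h1 : L.map N.subtype = ⊥ := hNess _ (Submodule.map_subtype_le N L) (by
      rw [eq_bot_iff]
      rintro _ ⟨⟨x, hx, rfl⟩, ⟨m, hm⟩⟩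
      have h2 : x ∈ L ⊓ LinearMap.range (j.codRestrict N (fun x => hMN ⟨x, rfl⟩)) :=
        ⟨hx, ⟨m, Subtype.ext hm⟩⟩
      rw [hL] at h2
      rw [(Submodule.mem_bot Λ).1 h2, map_zero]
      exact Submodule.zero_mem _)
    rw [eq_bot_iff]
    intro x hx
    have h2 : (x : I) ∈ L.map N.subtype := ⟨x, hx, rfl⟩
    rw [h1] at h2
    exact (Submodule.mem_bot Λ).2 (Subtype.ext ((Submodule.mem_bot Λ).1 h2))

end InjectiveEnvelope

section Duality

variable (k : Type u) [CommRing k]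

/-- The module `E(k / rad k)`: an injective envelope of `k` modulo its Jacobson radical, i.e. the
minimal injective cogenerator of an artinian ring `k`. -/
def MinInjCogenerator : Type u :=
  Classical.choose (exists_injectiveEnvelope k (k ⧸ Ring.jacobson k))

noncomputable instance : AddCommGroup (MinInjCogenerator k) :=
  Classical.choose (Classical.choose_spec (exists_injectiveEnvelope k (k ⧸ Ring.jacobson k)))

noncomputable instance : Module k (MinInjCogenerator k) :=
  Classical.choose (Classical.choose_spec
    (Classical.choose_spec (exists_injectiveEnvelope k (k ⧸ Ring.jacobson k))))

theorem exists_isInjectiveEnvelope_minInjCogenerator :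
    ∃ i : (k ⧸ Ring.jacobson k) →ₗ[k] MinInjCogenerator k, IsInjectiveEnvelope i :=
  Classical.choose_spec (Classical.choose_spec
    (Classical.choose_spec (exists_injectiveEnvelope k (k ⧸ Ring.jacobson k))))

variable (V : Type u) [AddCommGroup V] [Module k V]

/-- The usual duality `D V = Hom_k(V, E(k / rad k))` over an artin `k`-algebra. -/
def Dual : Type u := V →ₗ[k] MinInjCogenerator k

noncomputable instance : AddCommGroup (Dual k V) :=
  inferInstanceAs (AddCommGroup (V →ₗ[k] MinInjCogenerator k))

/-- A left `S`-module structure on `V` gives the right `S`-module structure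
`(f s)(v) = f (s v)` on `D V`. -/
noncomputable instance Dual.rightModule (S : Type u) [Ring S] [Module S V] [SMulCommClass S k V] :
    Module Sᵐᵒᵖ (Dual k V) where
  smul s f := LinearMap.comp (show V →ₗ[k] MinInjCogenerator k from f)
    (Module.toModuleEnd k V (unop s))
  one_smul f := LinearMap.ext fun v =>
    congrArg (show V →ₗ[k] MinInjCogenerator k from f) (one_smul S v)
  mul_smul s t f := LinearMap.ext fun v =>
    congrArg (show V →ₗ[k] MinInjCogenerator k from f) (mul_smul (unop t) (unop s) v)
  smul_zero _ := LinearMap.zero_comp _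
  smul_add _ _ _ := LinearMap.add_comp _ _ _
  add_smul s t f := LinearMap.ext fun v =>
    (congrArg (show V →ₗ[k] MinInjCogenerator k from f) (add_smul (unop s) (unop t) v)).trans
      (map_add (show V →ₗ[k] MinInjCogenerator k from f) _ _)
  zero_smul f := LinearMap.ext fun v =>
    (congrArg (show V →ₗ[k] MinInjCogenerator k from f) (zero_smul S v)).trans
      (map_zero (show V →ₗ[k] MinInjCogenerator k from f))

/-- A right `R`-module structure on `V` gives the left `R`-module structure
`(r f)(v) = f (v r)` on `D V`. -/
noncomputable instance Dual.leftModule (R : Type u) [Ring R] [Module Rᵐᵒᵖ V]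
    [SMulCommClass Rᵐᵒᵖ k V] : Module R (Dual k V) where
  smul r f := LinearMap.comp (show V →ₗ[k] MinInjCogenerator k from f)
    (Module.toModuleEnd k V (op r))
  one_smul f := LinearMap.ext fun v =>
    congrArg (show V →ₗ[k] MinInjCogenerator k from f) (one_smul Rᵐᵒᵖ v)
  mul_smul s t f := LinearMap.ext fun v =>
    congrArg (show V →ₗ[k] MinInjCogenerator k from f) (mul_smul (op t) (op s) v)
  smul_zero _ := LinearMap.zero_comp _
  smul_add _ _ _ := LinearMap.add_comp _ _ _
  add_smul s t f := LinearMap.ext fun v =>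
    (congrArg (show V →ₗ[k] MinInjCogenerator k from f) (add_smul (op s) (op t) v)).trans
      (map_add (show V →ₗ[k] MinInjCogenerator k from f) _ _)
  zero_smul f := LinearMap.ext fun v =>
    (congrArg (show V →ₗ[k] MinInjCogenerator k from f) (zero_smul Rᵐᵒᵖ v)).trans
      (map_zero (show V →ₗ[k] MinInjCogenerator k from f))

/-- If `V` is an `S`-`R`-bimodule, then `D V` is an `R`-`S`-bimodule. -/
instance Dual.smulCommClass (S R : Type u) [Ring S] [Ring R] [Module S V] [Module Rᵐᵒᵖ V]
    [SMulCommClass S k V] [SMulCommClass Rᵐᵒᵖ k V] [SMulCommClass S Rᵐᵒᵖ V] :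
    SMulCommClass R Sᵐᵒᵖ (Dual k V) where
  smul_comm r s f := LinearMap.ext fun v =>
    congrArg (show V →ₗ[k] MinInjCogenerator k from f) (smul_comm (unop s) (op r) v)

end Duality

/-! Right modules over a ring `R` are modules over `Rᵐᵒᵖ`; an `S`-`R`-bimodule `V` carries
commuting structures `Module S V` and `Module Rᵐᵒᵖ V`. -/

section Functors

variable (S R : Type u) [Ring S] [Ring R] (V : Type u) [AddCommGroup V] [Module S V]
  [Module Rᵐᵒᵖ V] [SMulCommClass S Rᵐᵒᵖ V]

/-- The group `Hom_R(V, M)` of homomorphisms of right `R`-modules. -/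
def RightHom (M : Type u) [AddCommGroup M] [Module Rᵐᵒᵖ M] : Type u := V →ₗ[Rᵐᵒᵖ] M

instance (M : Type u) [AddCommGroup M] [Module Rᵐᵒᵖ M] : AddCommGroup (RightHom R V M) :=
  inferInstanceAs (AddCommGroup (V →ₗ[Rᵐᵒᵖ] M))

/-- For an `S`-`R`-bimodule `V`, `Hom_R(V, M)` is a right `S`-module by `(f s)(v) = f (s v)`. -/
instance (M : Type u) [AddCommGroup M] [Module Rᵐᵒᵖ M] : Module Sᵐᵒᵖ (RightHom R V M) where
  smul s f := LinearMap.comp (show V →ₗ[Rᵐᵒᵖ] M from f) (Module.toModuleEnd Rᵐᵒᵖ V (unop s))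
  one_smul f := LinearMap.ext fun v => congrArg (show V →ₗ[Rᵐᵒᵖ] M from f) (one_smul S v)
  mul_smul s t f := LinearMap.ext fun v =>
    congrArg (show V →ₗ[Rᵐᵒᵖ] M from f) (mul_smul (unop t) (unop s) v)
  smul_zero _ := LinearMap.zero_comp _
  smul_add _ _ _ := LinearMap.add_comp _ _ _
  add_smul s t f := LinearMap.ext fun v =>
    (congrArg (show V →ₗ[Rᵐᵒᵖ] M from f) (add_smul (unop s) (unop t) v)).trans
      (map_add (show V →ₗ[Rᵐᵒᵖ] M from f) _ _)
  zero_smul f := LinearMap.ext fun v =>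
    (congrArg (show V →ₗ[Rᵐᵒᵖ] M from f) (zero_smul S v)).trans
      (map_zero (show V →ₗ[Rᵐᵒᵖ] M from f))

/-- The functor `Hom_R(V, -)` from right `R`-modules to right `S`-modules. -/
def homFunctor : ModuleCat.{u} Rᵐᵒᵖ ⥤ ModuleCat.{u} Sᵐᵒᵖ where
  obj M := ModuleCat.of Sᵐᵒᵖ (RightHom R V M)
  map {M N} φ := ModuleCat.ofHom (X := RightHom R V M) (Y := RightHom R V N)
    { toFun := fun f => LinearMap.comp φ.hom (show V →ₗ[Rᵐᵒᵖ] M from f)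
      map_add' := fun f g => LinearMap.comp_add (show V →ₗ[Rᵐᵒᵖ] M from f)
        (show V →ₗ[Rᵐᵒᵖ] M from g) φ.hom
      map_smul' := fun _ _ => rfl }

/-- The `R`-submodule of `V ⊗_ℤ M` generated by the elements `s v ⊗ m - v ⊗ m s`. -/
def balancedRelations (M : Type u) [AddCommGroup M] [Module Sᵐᵒᵖ M] :
    Submodule Rᵐᵒᵖ (V ⊗[ℤ] M) :=
  Submodule.span Rᵐᵒᵖ {x | ∃ (s : S) (v : V) (m : M), x = (s • v) ⊗ₜ m - v ⊗ₜ (op s • m)}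

/-- The tensor product `M ⊗_S V` of a right `S`-module `M` and an `S`-`R`-bimodule `V`, with its
right `R`-module structure coming from `V`. It is the quotient of the tensor product of abelian
groups by the relations `m s ⊗ v = m ⊗ s v`; in the tensor product over `ℤ` the factor `V` is
written first, so that `v ⊗ m` stands for `m ⊗ v`. -/
abbrev BalancedTensor (M : Type u) [AddCommGroup M] [Module Sᵐᵒᵖ M] : Type u :=
  (V ⊗[ℤ] M) ⧸ balancedRelations S R V M

/-- The map `φ ⊗_S V` induced by a homomorphism `φ` of right `S`-modules. -/
noncomputable def balancedTensorMap {M N : Type u} [AddCommGroup M] [Module Sᵐᵒᵖ M]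
    [AddCommGroup N] [Module Sᵐᵒᵖ N] (φ : M →ₗ[Sᵐᵒᵖ] N) :
    BalancedTensor S R V M →ₗ[Rᵐᵒᵖ] BalancedTensor S R V N :=
  Submodule.mapQ _ _ (TensorProduct.AlgebraTensorModule.lTensor Rᵐᵒᵖ V
    (φ.toAddMonoidHom.toIntLinearMap)) (by
      refine Submodule.span_le.2 ?_
      rintro _ ⟨s, v, m, rfl⟩
      refine Submodule.subset_span ⟨s, v, φ m, ?_⟩
      rw [map_sub]
      change (s • v) ⊗ₜ[ℤ] φ m - v ⊗ₜ[ℤ] φ (op s • m) = _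
      rw [map_smul])

/-- The functor `- ⊗_S V` from right `S`-modules to right `R`-modules. -/
noncomputable def tensorFunctor : ModuleCat.{u} Sᵐᵒᵖ ⥤ ModuleCat.{u} Rᵐᵒᵖ where
  obj M := ModuleCat.of Rᵐᵒᵖ (BalancedTensor S R V M)
  map φ := ModuleCat.ofHom (balancedTensorMap S R V φ.hom)
  map_id M := by
    refine ModuleCat.hom_ext (LinearMap.ext fun x => ?_)
    obtain ⟨x, rfl⟩ := Submodule.mkQ_surjective _ x
    induction x with
    | zero => simp
    | tmul v m => rfl
    | add x y hx hy => rw [map_add, map_add, hx, hy, map_add]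
  map_comp {M N P} φ ψ := by
    refine ModuleCat.hom_ext (LinearMap.ext fun x => ?_)
    obtain ⟨x, rfl⟩ := Submodule.mkQ_surjective _ x
    induction x with
    | zero => simp
    | tmul v m => rfl
    | add x y hx hy => rw [map_add, map_add, hx, hy, map_add]

end Functors

section Subcategories

variable {Λ : Type u} [Ring Λ]

/-- A cotorsion pair `(B, A)` in the category of finitely generated `Λ`-modules:
`B = KerExt¹(-, A)` and `A = KerExt¹(B, -)`. -/
structure IsCotorsionPair (B A : ObjectProperty (ModuleCat.{u} Λ)) : Prop where
  left_iff : ∀ X, B X ↔ Module.Finite Λ X ∧ ∀ Y, A Y → Subsingleton (Abelian.Ext X Y 1)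
  right_iff : ∀ Y, A Y ↔ Module.Finite Λ Y ∧ ∀ X, B X → Subsingleton (Abelian.Ext X Y 1)

/-- A resolving subcategory of the category of finitely generated `Λ`-modules: it contains the
finitely generated projective modules and is closed under extensions, kernels of epimorphisms and
direct summands. -/
structure IsResolving (B : ObjectProperty (ModuleCat.{u} Λ)) : Prop where
  finite : ∀ X, B X → Module.Finite Λ X
  projective : ∀ X : ModuleCat.{u} Λ, Module.Finite Λ X → Module.Projective Λ X → B X
  extensions : B.IsClosedUnderExtensions
  kernels : ∀ E : ShortComplex (ModuleCat.{u} Λ), E.ShortExact → Module.Finite Λ E.X₁ →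
    B E.X₂ → B E.X₃ → B E.X₁
  summands : B.IsStableUnderRetracts

/-- A cotorsion pair `(B, A)` is hereditary if `B` is resolving. -/
structure IsHereditaryCotorsionPair (B A : ObjectProperty (ModuleCat.{u} Λ)) : Prop where
  isCotorsionPair : IsCotorsionPair B A
  isResolving : IsResolving B

/-- `add T`: the direct summands of finite direct sums of copies of `T`. -/
def addClosure (T : Type u) [AddCommGroup T] [Module Λ T] : ObjectProperty (ModuleCat.{u} Λ) :=
  fun X => ∃ n : ℕ, Nonempty (Retract X (ModuleCat.of Λ (Fin n → T)))

/-- `T` is an Ext-projective generator of `A`: `T ∈ A ∩ KerExt¹(-, A)` and every `X ∈ A` admits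
an exact sequence `0 → X' → T_X → X → 0` with `T_X ∈ add T` and `X' ∈ A`. -/
structure IsExtProjectiveGenerator (T : Type u) [AddCommGroup T] [Module Λ T]
    (A : ObjectProperty (ModuleCat.{u} Λ)) : Prop where
  mem : A (ModuleCat.of Λ T)
  extProjective : ∀ X, A X → Subsingleton (Abelian.Ext (ModuleCat.of Λ T) X 1)
  generator : ∀ X, A X → ∃ (X' TX : ModuleCat.{u} Λ) (f : X' ⟶ TX) (g : TX ⟶ X) (w : f ≫ g = 0),
    A X' ∧ addClosure T TX ∧ (ShortComplex.mk f g w).ShortExact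

end Subcategories

/-- An `S`-`R`-bimodule `T` is Wakamatsu-tilting: `T` is finitely generated over `R`, the canonical
maps `S → End(T_R)` and `R → End(_S T)` are bijective, and `Ext_R^i(T, T) = 0 = Ext_S^i(T, T)` for
all `i > 0`. -/
structure IsWakamatsuTilting (S R T : Type u) [Ring S] [Ring R] [AddCommGroup T] [Module S T]
    [Module Rᵐᵒᵖ T] [SMulCommClass S Rᵐᵒᵖ T] : Prop where
  finite : Module.Finite Rᵐᵒᵖ T
  bijective_left : Function.Bijective (Module.toModuleEnd Rᵐᵒᵖ T : S →+* Module.End Rᵐᵒᵖ T)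
  bijective_right : haveI := SMulCommClass.symm S Rᵐᵒᵖ T
    Function.Bijective (Module.toModuleEnd S T : Rᵐᵒᵖ →+* Module.End S T)
  ext_right : ∀ i : ℕ, 0 < i →
    Subsingleton (Abelian.Ext (ModuleCat.of Rᵐᵒᵖ T) (ModuleCat.of Rᵐᵒᵖ T) i)
  ext_left : ∀ i : ℕ, 0 < i →
    Subsingleton (Abelian.Ext (ModuleCat.of S T) (ModuleCat.of S T) i)

/-- The functors `H` and `K` restrict to mutually quasi-inverse equivalences between the full
subcategories `P` and `Q`. -/
def RestrictToEquivalence {C D : Type*} [Category* C] [Category* D] (H : C ⥤ D) (K : D ⥤ C)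
    (P : ObjectProperty C) (Q : ObjectProperty D) : Prop :=
  ∃ (hH : ∀ X, P X → Q (H.obj X)) (hK : ∀ Y, Q Y → P (K.obj Y)),
    let H' : P.FullSubcategory ⥤ Q.FullSubcategory := Q.lift (P.ι ⋙ H) fun X => hH X.obj X.property
    let K' : Q.FullSubcategory ⥤ P.FullSubcategory := P.lift (Q.ι ⋙ K) fun Y => hK Y.obj Y.property
    Nonempty (H' ⋙ K' ≅ 𝟭 P.FullSubcategory) ∧ Nonempty (K' ⋙ H' ≅ 𝟭 Q.FullSubcategory)

/-- The bimodules `_S V_R` and `_R W_S` represent a cotorsion pair counter equivalence between the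
cotorsion pair `(B, A)` of right `R`-modules and the cotorsion pair `(G, K)` of right `S`-modules:
`Hom_R(V, -) : A ⇄ G : - ⊗_S V` and `Hom_S(W, -) : K ⇄ B : - ⊗_R W` are equivalences. -/
structure RepresentCounterEquivalence (S R V W : Type u) [Ring S] [Ring R]
    [AddCommGroup V] [Module S V] [Module Rᵐᵒᵖ V] [SMulCommClass S Rᵐᵒᵖ V]
    [AddCommGroup W] [Module R W] [Module Sᵐᵒᵖ W] [SMulCommClass R Sᵐᵒᵖ W]
    (B A : ObjectProperty (ModuleCat.{u} Rᵐᵒᵖ)) (G K : ObjectProperty (ModuleCat.{u} Sᵐᵒᵖ)) :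
    Prop where
  isCotorsionPair_left : IsCotorsionPair B A
  isCotorsionPair_right : IsCotorsionPair G K
  equivalence_left : RestrictToEquivalence (homFunctor S R V) (tensorFunctor S R V) A G
  equivalence_right : RestrictToEquivalence (homFunctor R S W) (tensorFunctor R S W) K B

end CounterEquivalence

/-! For finitely generated X, evaluation gives X ⊗_R DT ≅ D Hom_R(X, T) (`tensorDualMap_bijective`),
so K consists of the modules D Hom_R(X, T) with X in B. The proof rests on one pairing: a functional
ξ on Hom_R(X, Y) yields the S-homomorphism Hom_R(T, Y) → D Hom_R(X, T), g ↦ (f ↦ ξ(g ∘ f)). For X in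
B and Y in A this gives D Hom_R(X, Y) ≅ Hom_S(Hom_R(T, Y), D Hom_R(X, T)). It is injective because
every X → Y lifts along T_Y → Y and hence is a sum of maps through T (`exists_sum_comp_eq`); it is
surjective by `exists_dual_pairing_eq`.

Apply Hom_R(T, -) to 0 → Y' → T_Y → Y → 0. The result is exact with projective middle term, and the
pairing extends every map from its left term to D Hom_R(X, T). Hence Ext¹(G, K) = 0, and dimension
shifting gives Ext²(G, K) = 0, which makes G closed under kernels of epimorphisms. Taking X = R in
the pairing shows that the counit Hom_R(T, Y) ⊗_S T → Y is bijective on A. Since DR lies in A, T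
cogenerates B; a left add T-approximation of X in B has cokernel in B, so X is T-reflexive, and
therefore the unit X → Hom_S(DT, X ⊗_R DT) is bijective.

It remains to see that the two classes determine each other. If M is left orthogonal to K, compare D
Hom_R(X, M ⊗_S T) with Hom_S(M, D Hom_R(X, T)). They agree for X free, and orthogonality carries
this to all X in B along 0 → N → F → X → 0. This forces Ext¹_R(X, M ⊗_S T) = 0, so M ⊗_S T is in A,
and X = T gives M ≅ Hom_R(T, M ⊗_S T). If M = DL is right orthogonal to G, compare D Hom_R(Hom_S(L,
T), Y) with Hom_S(Hom_R(T, Y), DL). They agree for Y a power of DR, and the comparison extends to A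
along injective copresentations, whose cokernels stay in A because the pair is hereditary. So
Hom_S(L, T) is in B, and Y = T gives L ≅ Hom_R(Hom_S(L, T), T), whence M ≅ Hom_S(L, T) ⊗_R DT. -/

namespace CounterEquivalence

/-! ### Vanishing of Ext along retracts and short exact sequences -/

section ExtCategory

open Abelian

variable {C : Type*} [Category* C] [Abelian C] [HasExt.{u} C]

theorem subsingleton_ext_of_retract_left {X X' Y : C} {n : ℕ} (r : Retract X X')
    (h : Subsingleton (Ext X' Y n)) : Subsingleton (Ext X Y n) := by
  refine subsingleton_of_forall_eq 0 fun x => ?_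
  have h1 : (Ext.mk₀ r.i).comp ((Ext.mk₀ r.r).comp x (zero_add n)) (zero_add n) = x := by
    rw [Ext.mk₀_comp_mk₀_assoc, r.retract, Ext.mk₀_id_comp]
  rw [← h1, Subsingleton.elim ((Ext.mk₀ r.r).comp x (zero_add n)) 0, Ext.comp_zero]

theorem subsingleton_ext_of_retract_right {X Y Y' : C} {n : ℕ} (r : Retract Y Y')
    (h : Subsingleton (Ext X Y' n)) : Subsingleton (Ext X Y n) := by
  refine subsingleton_of_forall_eq 0 fun x => ?_
  have h1 : (x.comp (Ext.mk₀ r.i) (add_zero n)).comp (Ext.mk₀ r.r) (add_zero n) = x := by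
    rw [Ext.comp_assoc_of_third_deg_zero, Ext.mk₀_comp_mk₀, r.retract, Ext.comp_mk₀_id]
  rw [← h1, Subsingleton.elim (x.comp (Ext.mk₀ r.i) (add_zero n)) 0, Ext.zero_comp]

variable {E : ShortComplex C} (hE : E.ShortExact)
include hE

theorem subsingleton_ext_middle {Y : C} {n : ℕ} (h₁ : Subsingleton (Ext E.X₁ Y n))
    (h₃ : Subsingleton (Ext E.X₃ Y n)) : Subsingleton (Ext E.X₂ Y n) := by
  refine subsingleton_of_forall_eq 0 fun x => ?_
  obtain ⟨y, rfl⟩ := Ext.contravariant_sequence_exact₂ hE Y x (Subsingleton.elim _ _)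
  rw [Subsingleton.elim y 0, Ext.comp_zero]

theorem subsingleton_ext_left {Y : C} {n m : ℕ} (hm : 1 + n = m) (h₂ : Subsingleton (Ext E.X₂ Y n))
    (h₃ : Subsingleton (Ext E.X₃ Y m)) : Subsingleton (Ext E.X₁ Y n) := by
  refine subsingleton_of_forall_eq 0 fun x => ?_
  obtain ⟨y, rfl⟩ := Ext.contravariant_sequence_exact₁ hE Y x hm (Subsingleton.elim _ _)
  rw [Subsingleton.elim y 0, Ext.comp_zero]

theorem subsingleton_ext_right {Y : C} {n m : ℕ} (hm : 1 + n = m) (h₁ : Subsingleton (Ext E.X₁ Y n))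
    (h₂ : Subsingleton (Ext E.X₂ Y m)) : Subsingleton (Ext E.X₃ Y m) := by
  refine subsingleton_of_forall_eq 0 fun x => ?_
  obtain ⟨y, rfl⟩ := Ext.contravariant_sequence_exact₃ hE Y x (Subsingleton.elim _ _) hm
  rw [Subsingleton.elim y 0, Ext.comp_zero]

theorem exists_extension_of_subsingleton_ext {Y : C} (h : Subsingleton (Ext E.X₃ Y 1))
    (φ : E.X₁ ⟶ Y) : ∃ ψ : E.X₂ ⟶ Y, E.f ≫ ψ = φ := by
  obtain ⟨x, hx⟩ := Ext.contravariant_sequence_exact₁ hE Y (Ext.mk₀ φ) (add_zero 1)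
    (Subsingleton.elim _ _)
  obtain ⟨ψ, rfl⟩ := Ext.addEquiv₀.symm.surjective x
  refine ⟨ψ, Ext.addEquiv₀.symm.injective ?_⟩
  simpa using hx

/-- The connecting map Hom(X₁, Y) → Ext¹(X₃, Y) is onto because the middle Ext¹ vanishes, and it
kills every map that extends to X₂. -/
theorem subsingleton_ext_of_extension {Y : C} (h : Subsingleton (Ext E.X₂ Y 1))
    (hφ : ∀ φ : E.X₁ ⟶ Y, ∃ ψ : E.X₂ ⟶ Y, E.f ≫ ψ = φ) : Subsingleton (Ext E.X₃ Y 1) := by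
  refine subsingleton_of_forall_eq 0 fun x => ?_
  obtain ⟨y, rfl⟩ := Ext.contravariant_sequence_exact₃ hE Y x (Subsingleton.elim _ _) (add_zero 1)
  obtain ⟨φ, rfl⟩ := Ext.addEquiv₀.symm.surjective y
  obtain ⟨ψ, rfl⟩ := hφ φ
  simp [← Ext.mk₀_comp_mk₀, hE.extClass_comp_assoc]

theorem exists_lift_of_subsingleton_ext {X : C} (h : Subsingleton (Ext X E.X₁ 1))
    (φ : X ⟶ E.X₃) : ∃ ψ : X ⟶ E.X₂, ψ ≫ E.g = φ := by
  obtain ⟨x, hx⟩ := Ext.covariant_sequence_exact₃ X hE (Ext.mk₀ φ) (zero_add 1)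
    (Subsingleton.elim _ _)
  obtain ⟨ψ, rfl⟩ := Ext.addEquiv₀.symm.surjective x
  refine ⟨ψ, Ext.addEquiv₀.symm.injective ?_⟩
  simpa using hx

theorem subsingleton_ext_of_lift {X : C} (h : Subsingleton (Ext X E.X₂ 1))
    (hφ : ∀ φ : X ⟶ E.X₃, ∃ ψ : X ⟶ E.X₂, ψ ≫ E.g = φ) : Subsingleton (Ext X E.X₁ 1) := by
  refine subsingleton_of_forall_eq 0 fun x => ?_
  obtain ⟨y, rfl⟩ := Ext.covariant_sequence_exact₁ X hE x (Subsingleton.elim _ _) (zero_add 1)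
  obtain ⟨φ, rfl⟩ := Ext.addEquiv₀.symm.surjective y
  obtain ⟨ψ, rfl⟩ := hφ φ
  simp [← Ext.mk₀_comp_mk₀, Ext.comp_assoc_of_second_deg_zero, hE.comp_extClass]

end ExtCategory

/-! ### Ext¹ of modules, in terms of extending and lifting linear maps -/

section ExtModule

variable {Λ : Type u} [Ring Λ]

/-- The vanishing of `Ext¹_Λ(X, Y)`. -/
def ExtVanishes (Λ : Type u) [Ring Λ] (X Y : Type u) [AddCommGroup X] [Module Λ X]
    [AddCommGroup Y] [Module Λ Y] : Prop :=
  Subsingleton (Abelian.Ext (ModuleCat.of Λ X) (ModuleCat.of Λ Y) 1)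

variable {X Y Z : Type u} [AddCommGroup X] [Module Λ X] [AddCommGroup Y] [Module Λ Y]
  [AddCommGroup Z] [Module Λ Z]

theorem ExtVanishes.congr_left (e : X ≃ₗ[Λ] Y) (h : ExtVanishes Λ X Z) : ExtVanishes Λ Y Z :=
  subsingleton_ext_of_retract_left (Retract.ofIso e.symm.toModuleIso) h

theorem ExtVanishes.congr_right (e : X ≃ₗ[Λ] Y) (h : ExtVanishes Λ Z X) : ExtVanishes Λ Z Y :=
  subsingleton_ext_of_retract_right (Retract.ofIso e.symm.toModuleIso) h

theorem extVanishes_of_projective [Module.Projective Λ X] : ExtVanishes Λ X Y := by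
  have := (IsProjective.iff_projective (R := Λ) X).1 inferInstance
  exact Abelian.Ext.subsingleton_of_projective _ _ 0

theorem extVanishes_of_injective [Module.Injective Λ Y] : ExtVanishes Λ X Y := by
  have := Module.injective_object_of_injective_module Λ Y
  exact Abelian.Ext.subsingleton_of_injective _ _ 0

variable {X₁ X₂ X₃ : Type u} [AddCommGroup X₁] [Module Λ X₁] [AddCommGroup X₂] [Module Λ X₂]
  [AddCommGroup X₃] [Module Λ X₃] {f : X₁ →ₗ[Λ] X₂} {g : X₂ →ₗ[Λ] X₃}
  (hf : Function.Injective f) (hfg : Function.Exact f g) (hg : Function.Surjective g)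
include hf hg

theorem shortExact_of_exact : (ShortComplex.mk (ModuleCat.ofHom f) (ModuleCat.ofHom g)
    (ModuleCat.hom_ext (LinearMap.ext hfg.apply_apply_eq_zero))).ShortExact := by
  have := (ModuleCat.mono_iff_injective (ModuleCat.ofHom f)).2 hf
  have := (ModuleCat.epi_iff_surjective (ModuleCat.ofHom g)).2 hg
  exact ⟨(ShortComplex.ShortExact.moduleCat_exact_iff_function_exact _).2 hfg⟩

include hfg

theorem ExtVanishes.exists_extension (h : ExtVanishes Λ X₃ Y) (φ : X₁ →ₗ[Λ] Y) :
    ∃ ψ : X₂ →ₗ[Λ] Y, ∀ x, ψ (f x) = φ x := by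
  obtain ⟨ψ, hψ⟩ := exists_extension_of_subsingleton_ext (shortExact_of_exact hf hfg hg) h
    (ModuleCat.ofHom φ)
  exact ⟨ψ.hom, fun x => congrArg (fun t => t.hom x) hψ⟩

theorem ExtVanishes.of_extension (h : ExtVanishes Λ X₂ Y)
    (hφ : ∀ φ : X₁ →ₗ[Λ] Y, ∃ ψ : X₂ →ₗ[Λ] Y, ∀ x, ψ (f x) = φ x) : ExtVanishes Λ X₃ Y := by
  refine subsingleton_ext_of_extension (shortExact_of_exact hf hfg hg) h fun φ => ?_
  obtain ⟨ψ, hψ⟩ := hφ φ.hom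
  exact ⟨ModuleCat.ofHom ψ, ModuleCat.hom_ext (LinearMap.ext hψ)⟩

theorem ExtVanishes.exists_lift (h : ExtVanishes Λ X X₁) (φ : X →ₗ[Λ] X₃) :
    ∃ ψ : X →ₗ[Λ] X₂, ∀ x, g (ψ x) = φ x := by
  obtain ⟨ψ, hψ⟩ := exists_lift_of_subsingleton_ext (shortExact_of_exact hf hfg hg) h
    (ModuleCat.ofHom φ)
  exact ⟨ψ.hom, fun x => congrArg (fun t => t.hom x) hψ⟩

theorem ExtVanishes.of_lift (h : ExtVanishes Λ X X₂)
    (hφ : ∀ φ : X →ₗ[Λ] X₃, ∃ ψ : X →ₗ[Λ] X₂, ∀ x, g (ψ x) = φ x) : ExtVanishes Λ X X₁ := by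
  refine subsingleton_ext_of_lift (shortExact_of_exact hf hfg hg) h fun φ => ?_
  obtain ⟨ψ, hψ⟩ := hφ φ.hom
  exact ⟨ModuleCat.ofHom ψ, ModuleCat.hom_ext (LinearMap.ext hψ)⟩

end ExtModule

/-! ### Ext¹ out of finite powers -/

section FiniteSums

variable {Λ : Type u} [Ring Λ] {X Y : Type u} [AddCommGroup X] [Module Λ X] [AddCommGroup Y]
  [Module Λ Y]

theorem ExtVanishes.pi_left (h : ExtVanishes Λ X Y) (n : ℕ) : ExtVanishes Λ (Fin n → X) Y := by
  induction n with
  | zero => exact extVanishes_of_projective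
  | succ n ih =>
    refine subsingleton_ext_middle (shortExact_of_exact
      (f := LinearMap.single Λ (fun _ : Fin (n + 1) => X) 0)
      (g := LinearMap.funLeft Λ X Fin.succ) ?_ ?_ ?_) h ih
    · exact Pi.single_injective (M := fun _ : Fin (n + 1) => X) 0
    · intro v
      constructor
      · intro hv
        refine ⟨v 0, funext fun i => ?_⟩
        refine Fin.cases ?_ (fun i => ?_) i
        · simp
        · simpa using (congrFun hv i).symm
      · rintro ⟨x, rfl⟩
        funext i
        simp [LinearMap.funLeft_apply]
    · exact fun v => ⟨Fin.cons (α := fun _ => X) 0 v, rfl⟩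

end FiniteSums


/-! ### E(k / rad k) is an injective cogenerator -/

section MinimalCogenerator

variable {k : Type u} [CommRing k]

theorem injective_minInjCogenerator : Module.Injective k (MinInjCogenerator k) :=
  (exists_isInjectiveEnvelope_minInjCogenerator k).choose_spec.injective_module

/-- In the quotient of `k` by its Jacobson radical, the elements killed by a maximal ideal form a
module generated by any of its nonzero elements. -/
theorem exists_smul_eq_of_maximal_smul_eq_zero {m : Ideal k} (hm : m.IsMaximal)
    {a b : k ⧸ Ring.jacobson k} (ha : a ≠ 0) (hma : ∀ x ∈ m, x • a = 0)
    (hmb : ∀ x ∈ m, x • b = 0) : ∃ c : k, c • a = b := by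
  obtain ⟨a, rfl⟩ := Ideal.Quotient.mk_surjective a
  obtain ⟨b, rfl⟩ := Ideal.Quotient.mk_surjective b
  -- If a were in m it would kill its own class, so a² would lie in every maximal ideal, and then so
  -- would a. Hence a is invertible modulo m, and m kills the class of b.
  have ham : a ∉ m := by
    intro ham
    have h1 : a * a ∈ Ring.jacobson k := Ideal.Quotient.eq_zero_iff_mem.1 (hma a ham)
    refine ha (Ideal.Quotient.eq_zero_iff_mem.2 ?_)
    rw [Ring.jacobson_eq_sInf_isMaximal, Submodule.mem_sInf] at h1 ⊢
    intro I hI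
    exact (or_self_iff.1 ((Ideal.IsMaximal.isPrime hI).mem_or_mem (h1 I hI)))
  obtain ⟨c, x, hx, hcx⟩ := hm.exists_inv ham
  refine ⟨b * c, ?_⟩
  have h2 := hmb x hx
  change Ideal.Quotient.mk _ (b * c * a) = _
  change Ideal.Quotient.mk _ (x * b) = _ at h2
  have h3 : b = b * c * a + x * b := by linear_combination (-b) * hcx
  conv_rhs => rw [h3, map_add, h2, add_zero]

/-- A homomorphism from a simple module to the minimal injective cogenerator has its image in
`k / rad k`. -/
theorem exists_eq_of_isSimpleModule {i : (k ⧸ Ring.jacobson k) →ₗ[k] MinInjCogenerator k}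
    (hi : IsInjectiveEnvelope i) {V : Type u} [AddCommGroup V] [Module k V] [IsSimpleModule k V]
    (f : V →ₗ[k] MinInjCogenerator k) (v : V) : ∃ a, i a = f v := by
  rcases eq_or_ne f 0 with rfl | hf
  · exact ⟨0, by simp⟩
  have hker : LinearMap.ker f = ⊥ := (eq_bot_or_eq_top (LinearMap.ker f)).resolve_right
    fun h => hf (LinearMap.ker_eq_top.1 h)
  -- Otherwise the image of f would meet k / rad k trivially, against essentiality.
  have h1 : (LinearMap.range i).comap f = ⊤ := by
    refine (eq_bot_or_eq_top _).resolve_left fun h => hf ?_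
    refine LinearMap.range_eq_bot.1 (hi.essential _ ?_)
    rw [eq_bot_iff]
    rintro _ ⟨⟨w, rfl⟩, hw⟩
    have h2 : w ∈ (LinearMap.range i).comap f := hw
    rw [h] at h2
    simp [(Submodule.mem_bot k).1 h2]
  have h2 : v ∈ (LinearMap.range i).comap f := h1 ▸ Submodule.mem_top
  exact h2

/-- The cyclic module kv ≅ k/I maps onto some simple k/m, which embeds in k / rad k and so in E;
injectivity of E extends the composite to V. -/
theorem exists_dual_apply_ne_zero [IsArtinianRing k] {V : Type u} [AddCommGroup V] [Module k V] {v : V} (hv : v ≠ 0) :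
    ∃ φ : V →ₗ[k] MinInjCogenerator k, φ v ≠ 0 := by
  obtain ⟨i, hi⟩ := exists_isInjectiveEnvelope_minInjCogenerator k
  let I : Ideal k := LinearMap.ker (LinearMap.toSpanSingleton k V v)
  have hI : I ≠ ⊤ := fun h => hv (by
    have : (1 : k) ∈ I := h ▸ Submodule.mem_top
    simpa [I] using this)
  obtain ⟨m, hm, hIm⟩ := Ideal.exists_le_maximal I hI
  have hJ : Ring.jacobson k ≤ m := Ring.jacobson_le_of_isMaximal m
  have hss : IsSemisimpleRing (k ⧸ Ring.jacobson k) := inferInstance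
  -- Semisimplicity over the quotient ring passes to k along the identity map, semilinear over k → k
  -- / rad k.
  have : IsSemisimpleModule k (k ⧸ Ring.jacobson k) :=
    (LinearMap.isSemisimpleModule_iff_of_bijective
      (({ toFun := id, map_add' := fun _ _ => rfl, map_smul' := fun c x => by
            obtain ⟨x, rfl⟩ := Ideal.Quotient.mk_surjective x
            rfl } :
        (k ⧸ Ring.jacobson k) →ₛₗ[Ideal.Quotient.mk (Ring.jacobson k)] (k ⧸ Ring.jacobson k)))
      Function.bijective_id).2 hss
  have hq : Function.Surjective (Submodule.mapQ (Ring.jacobson k) m LinearMap.id hJ) := by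
    intro x
    obtain ⟨x, rfl⟩ := m.mkQ_surjective x
    exact ⟨Submodule.mkQ _ x, rfl⟩
  -- A section of k / rad k → k/m embeds the simple module in k / rad k.
  obtain ⟨s, hs⟩ := IsSemisimpleModule.lifting_property _ hq LinearMap.id
  have hsi : Function.Injective s := fun x y hxy => by
    rw [← LinearMap.id_apply (R := k) x, ← hs, LinearMap.comp_apply, hxy, ← LinearMap.comp_apply,
      hs, LinearMap.id_apply]
  obtain ⟨φ, hφ⟩ := injective_minInjCogenerator.out (I.liftQ (LinearMap.toSpanSingleton k V v)
    le_rfl) (LinearMap.ker_eq_bot.1 (Submodule.ker_liftQ_eq_bot' _ _ rfl))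
    (i ∘ₗ s ∘ₗ Submodule.mapQ I m LinearMap.id hIm)
  refine ⟨φ, fun h0 => ?_⟩
  have h1 := hφ (I.mkQ 1)
  simp only [Submodule.mkQ_apply, Submodule.liftQ_apply, LinearMap.toSpanSingleton_apply, one_smul,
    h0, LinearMap.comp_apply] at h1
  have h2 := hsi ((hi.injective_map (h1.symm.trans (map_zero i).symm)).trans (map_zero s).symm)
  exact hm.ne_top ((Ideal.eq_top_iff_one m).2 ((Submodule.Quotient.mk_eq_zero m).1 h2))

end MinimalCogenerator

/-! ### The exact functor D -/

section DualFunctor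

variable {k : Type u} [CommRing k] {V W : Type u} [AddCommGroup V] [Module k V]
    [AddCommGroup W] [Module k W]

noncomputable instance : FunLike (Dual k V) V (MinInjCogenerator k) :=
  inferInstanceAs (FunLike (V →ₗ[k] MinInjCogenerator k) V (MinInjCogenerator k))

noncomputable instance : LinearMapClass (Dual k V) k V (MinInjCogenerator k) :=
  inferInstanceAs (LinearMapClass (V →ₗ[k] MinInjCogenerator k) k V (MinInjCogenerator k))

noncomputable instance : Module k (Dual k V) :=
  inferInstanceAs (Module k (V →ₗ[k] MinInjCogenerator k))

@[ext] theorem Dual.ext {φ ψ : Dual k V} (h : ∀ v, φ v = ψ v) : φ = ψ := LinearMap.ext h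

/-- A linear map to the minimal injective cogenerator, viewed as an element of the dual. -/
def Dual.of (f : V →ₗ[k] MinInjCogenerator k) : Dual k V := f

@[simp] theorem Dual.of_apply (f : V →ₗ[k] MinInjCogenerator k) (v : V) : Dual.of f v = f v := rfl

@[simp] theorem Dual.add_apply (φ ψ : Dual k V) (v : V) : (φ + ψ) v = φ v + ψ v := rfl
@[simp] theorem Dual.zero_apply (v : V) : (0 : Dual k V) v = 0 := rfl
@[simp] theorem Dual.smul_apply (c : k) (φ : Dual k V) (v : V) : (c • φ) v = c • φ v := rfl

@[simp] theorem Dual.right_smul_apply {S : Type u} [Ring S] [Module S V] [SMulCommClass S k V]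
    (s : Sᵐᵒᵖ) (φ : Dual k V) (v : V) : (s • φ) v = φ (unop s • v) := rfl

@[simp] theorem Dual.left_smul_apply {R : Type u} [Ring R] [Module Rᵐᵒᵖ V]
    [SMulCommClass Rᵐᵒᵖ k V] (r : R) (φ : Dual k V) (v : V) : (r • φ) v = φ (op r • v) := rfl

instance {S : Type u} [Ring S] [Algebra k S] [Module S V] [IsScalarTower k S V] :
    IsScalarTower k Sᵐᵒᵖ (Dual k V) where
  smul_assoc c s φ := Dual.ext fun v => by simp

instance {R : Type u} [Ring R] [Algebra k R] [Module Rᵐᵒᵖ V] [IsScalarTower k Rᵐᵒᵖ V] :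
    IsScalarTower k R (Dual k V) where
  smul_assoc c r φ := Dual.ext fun v => by simp

/-- Evaluation `V → D D V`. -/
noncomputable def Dual.eval (k : Type u) [CommRing k] (V : Type u) [AddCommGroup V] [Module k V] :
    V →ₗ[k] Dual k (Dual k V) where
  toFun v := Dual.of
    { toFun := fun φ => φ v, map_add' := fun _ _ => rfl, map_smul' := fun _ _ => rfl }
  map_add' v w := Dual.ext fun φ => map_add φ v w
  map_smul' c v := Dual.ext fun φ => map_smul φ c v

@[simp] theorem Dual.eval_apply (v : V) (φ : Dual k V) : Dual.eval k V v φ = φ v := rfl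

/-- The map `D W → D V` induced by a linear map `V → W`. -/
noncomputable def Dual.map (f : V →ₗ[k] W) : Dual k W →ₗ[k] Dual k V where
  toFun φ := (show W →ₗ[k] MinInjCogenerator k from φ) ∘ₗ f
  map_add' _ _ := rfl
  map_smul' _ _ := rfl

@[simp] theorem Dual.map_apply (f : V →ₗ[k] W) (φ : Dual k W) (v : V) :
  Dual.map f φ v = φ (f v) := rfl

theorem Dual.map_surjective {f : V →ₗ[k] W} (hf : Function.Injective f) :
    Function.Surjective (Dual.map f) := fun φ => by
  obtain ⟨ψ, hψ⟩ := injective_minInjCogenerator.out f hf φ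
  exact ⟨ψ, Dual.ext hψ⟩

section Artinian

variable [IsArtinianRing k]

theorem Dual.exists_apply_ne_zero {v : V} (hv : v ≠ 0) : ∃ φ : Dual k V, φ v ≠ 0 :=
  exists_dual_apply_ne_zero hv

theorem Dual.eq_zero_of_forall {v : V} (h : ∀ φ : Dual k V, φ v = 0) : v = 0 := by
  by_contra hv
  obtain ⟨φ, hφ⟩ := Dual.exists_apply_ne_zero (k := k) hv
  exact hφ (h φ)

theorem Dual.eval_injective : Function.Injective (Dual.eval k V) :=
  (injective_iff_map_eq_zero _).2 fun _ hv => Dual.eq_zero_of_forall fun φ => DFunLike.congr_fun hv φ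

/-- Functionals separate the points of the cokernel. This turns surjectivity into a statement about
functionals, which is how the pairings below are exploited. -/
theorem Dual.surjective_of_forall {f : V →ₗ[k] W}
    (h : ∀ φ : Dual k W, (∀ v, φ (f v) = 0) → φ = 0) : Function.Surjective f := by
  intro w
  refine (Submodule.Quotient.mk_eq_zero (LinearMap.range f)).1
    (Dual.eq_zero_of_forall (k := k) fun φ => ?_)
  refine DFunLike.congr_fun (h (Dual.map (LinearMap.range f).mkQ φ) fun v => ?_) w
  rw [Dual.map_apply, Submodule.mkQ_apply,
    (Submodule.Quotient.mk_eq_zero (LinearMap.range f)).2 ⟨v, rfl⟩, map_zero]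

end Artinian

/-- A functional on W that vanishes on ker g descends to W / ker g, which embeds in X; injectivity
of E extends it. -/
theorem Dual.exact_map {X : Type u} [AddCommGroup X] [Module k X] {f : V →ₗ[k] W} {g : W →ₗ[k] X}
    (hfg : Function.Exact f g) : Function.Exact (Dual.map g) (Dual.map f) := by
  intro φ
  constructor
  · intro hφ
    have h1 : LinearMap.ker g ≤ LinearMap.ker (show W →ₗ[k] MinInjCogenerator k from φ) := by
      intro w hw
      obtain ⟨v, rfl⟩ := (hfg w).1 hw
      exact DFunLike.congr_fun hφ v
    obtain ⟨ψ, hψ⟩ := injective_minInjCogenerator.out ((LinearMap.ker g).liftQ g le_rfl)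
      (LinearMap.ker_eq_bot.1 (Submodule.ker_liftQ_eq_bot' _ _ rfl)) ((LinearMap.ker g).liftQ _ h1)
    exact ⟨ψ, Dual.ext fun w => hψ ((LinearMap.ker g).mkQ w)⟩
  · rintro ⟨ψ, rfl⟩
    exact Dual.ext fun v => by simp [hfg.apply_apply_eq_zero]

theorem Dual.map_injective {f : V →ₗ[k] W} (hf : Function.Surjective f) :
    Function.Injective (Dual.map f) := fun φ ψ h => Dual.ext fun w => by
  obtain ⟨v, rfl⟩ := hf w
  exact DFunLike.congr_fun h v

end DualFunctor

/-! ### D is a duality on modules of finite length -/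

section FiniteLength

variable {k : Type u} [CommRing k] [IsArtinianRing k]

/-- For a generator v of V, evaluation at v embeds DV into the part of k / rad k killed by the
maximal ideal ann(v), and any nonzero element generates that part. -/
theorem isSimpleModule_dual (V : Type u) [AddCommGroup V] [Module k V] [IsSimpleModule k V] :
    IsSimpleModule k (Dual k V) := by
  obtain ⟨i, hi⟩ := exists_isInjectiveEnvelope_minInjCogenerator k
  have := IsSimpleModule.nontrivial k V
  obtain ⟨v, hv⟩ := exists_ne (0 : V)
  have hspan : ∀ w : V, ∃ c : k, c • v = w := fun w =>
    LinearMap.mem_range.1 ((IsSimpleModule.toSpanSingleton_surjective k hv) w)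
  obtain ⟨φ₀, hφ₀⟩ := Dual.exists_apply_ne_zero (k := k) hv
  have : Nontrivial (Dual k V) := ⟨φ₀, 0, fun h => hφ₀ (by rw [h]; rfl)⟩
  rw [isSimpleModule_iff_toSpanSingleton_surjective]
  refine ⟨this, fun φ hφ ψ => ?_⟩
  have hφv : φ v ≠ 0 := fun h => hφ (Dual.ext fun w => by
    obtain ⟨c, rfl⟩ := hspan w
    rw [map_smul, h, smul_zero, Dual.zero_apply])
  obtain ⟨a, ha : i a = φ v⟩ := exists_eq_of_isSimpleModule hi φ v
  obtain ⟨b, hb : i b = ψ v⟩ := exists_eq_of_isSimpleModule hi ψ v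
  have hm := IsSimpleModule.ker_toSpanSingleton_isMaximal k hv
  have hkill : ∀ (χ : Dual k V) (e : k ⧸ Ring.jacobson k), i e = χ v →
      ∀ x ∈ LinearMap.ker (LinearMap.toSpanSingleton k V v), x • e = 0 := by
    intro χ e he x hx
    refine hi.injective_map ?_
    have hxv : x • v = 0 := hx
    rw [map_smul, he, map_zero, ← map_smul χ, hxv, map_zero]
  obtain ⟨c, rfl⟩ := exists_smul_eq_of_maximal_smul_eq_zero hm
    (fun h => hφv (by rw [← ha, h, map_zero])) (hkill φ a ha) (hkill ψ b hb)
  refine ⟨c, Dual.ext fun w => ?_⟩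
  obtain ⟨d, rfl⟩ := hspan w
  rw [LinearMap.toSpanSingleton_apply, Dual.smul_apply, map_smul, map_smul, smul_comm, ← hb,
    map_smul, ha]

/-- Induction on length. For a simple module the double dual is again simple and evaluation is
nonzero; the inductive step is a diagram chase along 0 → N → V → V/N → 0. -/
theorem isFiniteLength_dual_and_eval_surjective {V : Type u} [AddCommGroup V] [Module k V]
    (h : IsFiniteLength k V) :
    IsFiniteLength k (Dual k V) ∧ Function.Surjective (Dual.eval k V) := by
  induction h with
  | @of_subsingleton V =>
    have : Subsingleton (Dual k V) := subsingleton_of_forall_eq 0 fun φ => Dual.ext fun v => by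
      rw [Subsingleton.elim v 0, map_zero, map_zero]
    refine ⟨.of_subsingleton, fun φ => ⟨0, Dual.ext fun x => ?_⟩⟩
    rw [Subsingleton.elim x 0, map_zero, map_zero]
  | @of_simple_quotient V _ _ N _ hN ih =>
    have hsub := N.injective_subtype
    have hmk := N.mkQ_surjective
    have hex : Function.Exact N.subtype N.mkQ := LinearMap.exact_subtype_mkQ N
    have := isSimpleModule_dual (k := k) (V ⧸ N)
    constructor
    · rw [isFiniteLength_iff_isNoetherian_isArtinian] at ih ⊢
      obtain ⟨⟨_, _⟩, -⟩ := ih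
      exact ⟨isNoetherian_of_range_eq_ker _ _ (Dual.exact_map hex).linearMap_ker_eq.symm,
        isArtinian_of_range_eq_ker _ _ (Dual.exact_map hex).linearMap_ker_eq.symm⟩
    · intro α
      have := isSimpleModule_dual (k := k) (Dual k (V ⧸ N))
      have hq : Function.Surjective (Dual.eval k (V ⧸ N)) := by
        have := IsSimpleModule.nontrivial k (V ⧸ N)
        obtain ⟨v, hv⟩ := exists_ne (0 : V ⧸ N)
        refine (LinearMap.surjective_or_eq_zero _).resolve_right fun h0 => hv ?_
        exact Dual.eval_injective (by rw [h0]; simp)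
      obtain ⟨x, hx⟩ := hq (Dual.map (Dual.map N.mkQ) α)
      obtain ⟨v, rfl⟩ := hmk x
      -- After subtracting evaluation at v, α dies in DD(V/N), so it comes from DDN, where the
      -- induction hypothesis applies.
      have h1 : Dual.map (Dual.map N.mkQ) (α - Dual.eval k V v) = 0 := by
        rw [map_sub, ← hx, sub_eq_zero]
        rfl
      obtain ⟨β, hβ⟩ := (Dual.exact_map (Dual.exact_map hex) _).1 h1
      obtain ⟨n, rfl⟩ := ih.2 β
      refine ⟨v + n, ?_⟩
      rw [map_add, ← eq_sub_iff_add_eq', ← hβ]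
      rfl

variable (V : Type u) [AddCommGroup V] [Module k V] [Module.Finite k V]

theorem isFiniteLength_of_finite : IsFiniteLength k V :=
  isFiniteLength_iff_isNoetherian_isArtinian.2 ⟨inferInstance, inferInstance⟩

theorem Dual.eval_bijective : Function.Bijective (Dual.eval k V) :=
  ⟨Dual.eval_injective, (isFiniteLength_dual_and_eval_surjective (isFiniteLength_of_finite V)).2⟩

instance Dual.finite : Module.Finite k (Dual k V) := by
  have := (isFiniteLength_iff_isNoetherian_isArtinian.1
    (isFiniteLength_dual_and_eval_surjective (isFiniteLength_of_finite (k := k) V)).1).1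
  infer_instance

end FiniteLength


/-! ### Hom_R(V, -) with its right S-action -/

section RightHom

variable {S R V : Type u} [Ring S] [Ring R] [AddCommGroup V] [Module S V]
  [Module Rᵐᵒᵖ V] [SMulCommClass S Rᵐᵒᵖ V] {M N P : Type u} [AddCommGroup M] [Module Rᵐᵒᵖ M]
  [AddCommGroup N] [Module Rᵐᵒᵖ N] [AddCommGroup P] [Module Rᵐᵒᵖ P]

theorem smulCommClass_op : SMulCommClass Rᵐᵒᵖ S V :=
  SMulCommClass.symm _ _ _

attribute [local instance] smulCommClass_op

/-- A linear map, viewed as an element of `RightHom R V M`. -/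
def RightHom.of (f : V →ₗ[Rᵐᵒᵖ] M) : RightHom R V M := f

/-- The linear map underlying an element of `RightHom R V M`. -/
def RightHom.hom (f : RightHom R V M) : V →ₗ[Rᵐᵒᵖ] M := f

@[simp] theorem RightHom.hom_of (f : V →ₗ[Rᵐᵒᵖ] M) : (RightHom.of f).hom = f := rfl
@[simp] theorem RightHom.hom_add (f g : RightHom R V M) : (f + g).hom = f.hom + g.hom := rfl
@[simp] theorem RightHom.of_zero : RightHom.of (0 : V →ₗ[Rᵐᵒᵖ] M) = 0 := rfl
theorem RightHom.of_add (f g : V →ₗ[Rᵐᵒᵖ] M) :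
    RightHom.of (f + g) = RightHom.of f + RightHom.of g := rfl

theorem RightHom.of_sum {ι : Type*} (s : Finset ι) (f : ι → (V →ₗ[Rᵐᵒᵖ] M)) :
    RightHom.of (∑ i ∈ s, f i) = ∑ i ∈ s, RightHom.of (f i) :=
  map_sum (⟨⟨RightHom.of, rfl⟩, RightHom.of_add⟩ : (V →ₗ[Rᵐᵒᵖ] M) →+ RightHom R V M) f s

@[ext] theorem RightHom.ext {f g : RightHom R V M} (h : ∀ v, f.hom v = g.hom v) : f = g :=
  LinearMap.ext h

@[simp] theorem RightHom.smul_hom_apply (s : Sᵐᵒᵖ) (f : RightHom R V M) (v : V) :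
    (s • f).hom v = f.hom (unop s • v) := rfl

variable (S V) in
/-- The map `Hom_R(V, M) → Hom_R(V, N)` induced by `M → N`. -/
def RightHom.map (φ : M →ₗ[Rᵐᵒᵖ] N) : RightHom R V M →ₗ[Sᵐᵒᵖ] RightHom R V N where
  toFun f := RightHom.of (φ ∘ₗ f.hom)
  map_add' _ _ := LinearMap.comp_add _ _ φ
  map_smul' _ _ := rfl

theorem RightHom.map_injective {φ : M →ₗ[Rᵐᵒᵖ] N} (hφ : Function.Injective φ) :
    Function.Injective (RightHom.map S V φ) := fun _ _ h => RightHom.ext fun v =>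
  hφ (LinearMap.congr_fun (congrArg RightHom.hom h) v)

theorem exists_comp_eq_of_exact {X : Type u} [AddCommGroup X] [Module Rᵐᵒᵖ X]
    {φ : M →ₗ[Rᵐᵒᵖ] N} {ψ : N →ₗ[Rᵐᵒᵖ] P} (hφ : Function.Injective φ)
    (h : Function.Exact φ ψ) (g : X →ₗ[Rᵐᵒᵖ] N) (hg : ψ ∘ₗ g = 0) :
    ∃ g' : X →ₗ[Rᵐᵒᵖ] M, φ ∘ₗ g' = g := by
  let e := LinearEquiv.ofInjective φ hφ
  have h1 : ∀ x, g x ∈ LinearMap.range φ := fun x => (h (g x)).1 (LinearMap.congr_fun hg x)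
  refine ⟨e.symm.toLinearMap ∘ₗ g.codRestrict _ h1, LinearMap.ext fun x => ?_⟩
  have h2 := congrArg Subtype.val (e.apply_symm_apply (g.codRestrict _ h1 x))
  exact h2

theorem RightHom.map_exact {φ : M →ₗ[Rᵐᵒᵖ] N} {ψ : N →ₗ[Rᵐᵒᵖ] P} (hφ : Function.Injective φ)
    (h : Function.Exact φ ψ) : Function.Exact (RightHom.map S V φ) (RightHom.map S V ψ) := by
  intro g
  constructor
  · intro hg
    exact exists_comp_eq_of_exact hφ h g.hom hg
  · rintro ⟨f, rfl⟩
    exact RightHom.ext fun v => h.apply_apply_eq_zero _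

section Scalars

variable {k : Type u} [CommRing k] [Module k M] [SMulCommClass Rᵐᵒᵖ k M]

instance : Module k (RightHom R V M) := inferInstanceAs (Module k (V →ₗ[Rᵐᵒᵖ] M))

@[simp] theorem RightHom.scalar_smul_hom (c : k) (f : RightHom R V M) :
    (c • f).hom = c • f.hom := rfl

instance [Algebra k R] [Algebra k S] [Module k V] [IsScalarTower k S V] [IsScalarTower k Rᵐᵒᵖ V]
    {M : Type u} [AddCommGroup M] [Module Rᵐᵒᵖ M] [Module k M] [IsScalarTower k Rᵐᵒᵖ M] :
    IsScalarTower k Sᵐᵒᵖ (RightHom R V M) where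
  smul_assoc c s f := RightHom.ext fun v => by
    simp only [RightHom.smul_hom_apply, RightHom.scalar_smul_hom, LinearMap.smul_apply, unop_smul,
      smul_assoc]
    exact LinearMap.map_smul_of_tower f.hom c _

end Scalars

end RightHom

/-! ### The balanced tensor product and the tensor-Hom adjunction -/

section Balanced

attribute [local instance] smulCommClass_op

variable {S R V : Type u} [Ring S] [Ring R] [AddCommGroup V] [Module S V]
  [Module Rᵐᵒᵖ V] [SMulCommClass S Rᵐᵒᵖ V] {M N P : Type u} [AddCommGroup M] [Module Sᵐᵒᵖ M]
  [AddCommGroup N] [Module Rᵐᵒᵖ N]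

variable (S R) in
/-- The pure tensor `m ⊗ v` in `M ⊗_S V`. -/
def BalancedTensor.tmul (v : V) (m : M) : BalancedTensor S R V M := Submodule.Quotient.mk (v ⊗ₜ m)

omit [SMulCommClass S Rᵐᵒᵖ V] in
theorem BalancedTensor.smul_tmul (s : S) (v : V) (m : M) :
    BalancedTensor.tmul S R (s • v) m = BalancedTensor.tmul S R v (op s • m) :=
  (Submodule.Quotient.eq _).2 (Submodule.subset_span ⟨s, v, m, rfl⟩)

omit [SMulCommClass S Rᵐᵒᵖ V] in
theorem BalancedTensor.add_tmul (v w : V) (m : M) :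
    (BalancedTensor.tmul S R (v + w) m : BalancedTensor S R V M) =
      BalancedTensor.tmul S R v m + BalancedTensor.tmul S R w m :=
  congrArg Submodule.Quotient.mk (TensorProduct.add_tmul v w m)

omit [SMulCommClass S Rᵐᵒᵖ V] in
theorem BalancedTensor.tmul_add (v : V) (m n : M) :
    (BalancedTensor.tmul S R v (m + n) : BalancedTensor S R V M) =
      BalancedTensor.tmul S R v m + BalancedTensor.tmul S R v n :=
  congrArg Submodule.Quotient.mk (TensorProduct.tmul_add v m n)

omit [SMulCommClass S Rᵐᵒᵖ V] in
theorem BalancedTensor.induction {p : BalancedTensor S R V M → Prop} (h0 : p 0)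
    (htmul : ∀ v m, p (BalancedTensor.tmul S R v m)) (hadd : ∀ x y, p x → p y → p (x + y))
    (x : BalancedTensor S R V M) : p x := by
  obtain ⟨x, rfl⟩ := Submodule.mkQ_surjective _ x
  induction x with
  | zero => rwa [map_zero]
  | tmul v m => exact htmul v m
  | add x y hx hy => rw [map_add]; exact hadd _ _ hx hy

omit [SMulCommClass S Rᵐᵒᵖ V] in
@[ext] theorem BalancedTensor.hom_ext {f g : BalancedTensor S R V M →ₗ[Rᵐᵒᵖ] N}
    (h : ∀ v m, f (BalancedTensor.tmul S R v m) = g (BalancedTensor.tmul S R v m)) : f = g :=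
  LinearMap.ext fun x => BalancedTensor.induction (p := fun x => f x = g x) (by simp) h
    (fun x y hx hy => by rw [map_add, map_add, hx, hy]) x

/-- The homomorphism `M ⊗_S V → N` corresponding to `M → Hom_R(V, N)`. -/
noncomputable def BalancedTensor.lift (φ : M →ₗ[Sᵐᵒᵖ] RightHom R V N) :
    BalancedTensor S R V M →ₗ[Rᵐᵒᵖ] N :=
  Submodule.liftQ _ (TensorProduct.AlgebraTensorModule.lift
    { toFun := fun v =>
        { toFun := fun m => (φ m).hom v
          map_add' := fun m n => by rw [map_add]; rfl
          map_smul' := fun c m => by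
            rw [map_zsmul]
            exact map_zsmul (⟨⟨fun f : RightHom R V N => f.hom v, rfl⟩, fun _ _ => rfl⟩ :
              RightHom R V N →+ N) c (φ m) }
      map_add' := fun v w => LinearMap.ext fun m => map_add (φ m).hom v w
      map_smul' := fun r v => LinearMap.ext fun m => map_smul (φ m).hom r v }) (by
    refine Submodule.span_le.2 ?_
    rintro _ ⟨s, v, m, rfl⟩
    rw [SetLike.mem_coe, LinearMap.mem_ker, map_sub, sub_eq_zero]
    change (φ m).hom (s • v) = (φ (op s • m)).hom v
    rw [map_smul φ]
    rfl)

@[simp] theorem BalancedTensor.lift_tmul (φ : M →ₗ[Sᵐᵒᵖ] RightHom R V N) (v : V) (m : M) :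
    BalancedTensor.lift φ (BalancedTensor.tmul S R v m) = (φ m).hom v := rfl

variable (S R V M) in
/-- The unit `M → Hom_R(V, M ⊗_S V)`. -/
noncomputable def BalancedTensor.unit : M →ₗ[Sᵐᵒᵖ] RightHom R V (BalancedTensor S R V M) where
  toFun m := RightHom.of (R := R)
    { toFun := fun v => BalancedTensor.tmul S R v m
      map_add' := fun v w => BalancedTensor.add_tmul v w m
      map_smul' := fun _ _ => rfl }
  map_add' m n := RightHom.ext fun v => BalancedTensor.tmul_add v m n
  map_smul' s m := RightHom.ext fun v => (BalancedTensor.smul_tmul (unop s) v m).symm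

variable (S R V) in
/-- Tensoring is left adjoint to `Hom`. -/
noncomputable def tensorHomAdjunction : tensorFunctor S R V ⊣ homFunctor S R V :=
  Adjunction.mkOfUnitCounit
    { unit :=
        { app := fun M => ModuleCat.ofHom (BalancedTensor.unit S R V M)
          naturality := fun _ _ _ => rfl }
      counit :=
        { app := fun N => ModuleCat.ofHom (BalancedTensor.lift (N := N)
            (LinearMap.id (R := Sᵐᵒᵖ) (M := RightHom R V N)))
          naturality := fun M N f => ModuleCat.hom_ext
            (BalancedTensor.hom_ext (S := S) (V := V) (M := RightHom R V M) (N := N)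
              (fun _ _ => rfl)) }
      left_triangle := by
        refine NatTrans.ext (funext fun M => ModuleCat.hom_ext ?_)
        exact BalancedTensor.hom_ext (S := S) (V := V) (M := M) (N := BalancedTensor S R V M)
          fun _ _ => rfl
      right_triangle := by
        ext M
        rfl }

end Balanced


/-! ### Hom_R(X, DR) ≅ DX, and injectivity of DR -/

section Coinduction

variable {k R X : Type u} [CommRing k] [Ring R] [Algebra k R] [AddCommGroup X] [Module k X]
  [Module Rᵐᵒᵖ X] [IsScalarTower k Rᵐᵒᵖ X]

variable (R) in
/-- The homomorphism `X → D R` corresponding to an element of `D X`. -/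
noncomputable def Dual.coind (φ : Dual k X) : X →ₗ[Rᵐᵒᵖ] Dual k R where
  toFun x := Dual.of
    { toFun := fun r => φ (op r • x)
      map_add' := fun r s => by rw [MulOpposite.op_add, add_smul, map_add]
      map_smul' := fun c r => by rw [op_smul, smul_assoc, map_smul, RingHom.id_apply] }
  map_add' x y := Dual.ext fun r => (congrArg φ (smul_add (op r) x y)).trans (map_add φ _ _)
  map_smul' s x := Dual.ext fun r => congrArg φ (mul_smul (op r) s x).symm

@[simp] theorem Dual.coind_apply (φ : Dual k X) (x : X) (r : R) :
    Dual.coind R φ x r = φ (op r • x) := rfl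

/-- The element of `D X` corresponding to a homomorphism `X → D R`. -/
noncomputable def Dual.evalOne (h : X →ₗ[Rᵐᵒᵖ] Dual k R) : Dual k X :=
  Dual.of
    { toFun := fun x => h x 1
      map_add' := fun x y => by rw [map_add, Dual.add_apply]
      map_smul' := fun c x => by
        rw [LinearMap.map_smul_of_tower, Dual.smul_apply, RingHom.id_apply] }

@[simp] theorem Dual.evalOne_apply (h : X →ₗ[Rᵐᵒᵖ] Dual k R) (x : X) :
    Dual.evalOne h x = h x 1 := rfl

theorem Dual.coind_evalOne (h : X →ₗ[Rᵐᵒᵖ] Dual k R) : Dual.coind R (Dual.evalOne h) = h :=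
  LinearMap.ext fun x => Dual.ext fun r => by
    rw [Dual.coind_apply, Dual.evalOne_apply, map_smul, Dual.right_smul_apply, unop_op,
      smul_eq_mul, mul_one]

/-- Through `Dual.coind` and `Dual.evalOne`, extending a map into DR amounts to extending a
k-functional. -/
instance Dual.injective : Module.Injective Rᵐᵒᵖ (Dual k R) where
  out X Y _ _ _ _ f hf g := by
    let := Module.restrictScalars k Rᵐᵒᵖ X
    let := Module.restrictScalars k Rᵐᵒᵖ Y
    have := IsScalarTower.restrictScalars k Rᵐᵒᵖ X
    have := IsScalarTower.restrictScalars k Rᵐᵒᵖ Y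
    obtain ⟨φ, hφ⟩ := Dual.map_surjective (f := f.restrictScalars k) hf (Dual.evalOne g)
    refine ⟨Dual.coind R φ, fun x => ?_⟩
    rw [← Dual.coind_evalOne g, ← hφ]
    refine Dual.ext fun r => ?_
    simp

end Coinduction

/-! ### D on homomorphisms of left modules -/

section RightMap

attribute [local instance] smulCommClass_op

variable {k S V W : Type u} [CommRing k] [Ring S] [Algebra k S] [AddCommGroup V] [Module k V]
  [Module S V] [IsScalarTower k S V] [AddCommGroup W] [Module k W] [Module S W]
  [IsScalarTower k S W]

variable (k) in
/-- The homomorphism of right modules `D W → D V` induced by a homomorphism of left modules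
`V → W`. -/
noncomputable def Dual.rightMap (f : V →ₗ[S] W) : Dual k W →ₗ[Sᵐᵒᵖ] Dual k V where
  toFun φ := Dual.map (f.restrictScalars k) φ
  map_add' _ _ := rfl
  map_smul' s φ := Dual.ext fun v => congrArg φ (map_smul f (unop s) v).symm

@[simp] theorem Dual.rightMap_apply (f : V →ₗ[S] W) (φ : Dual k W) (v : V) :
    Dual.rightMap k f φ v = φ (f v) := rfl

variable {T : Type u} [AddCommGroup T] [Module k T] [Module S T] [IsScalarTower k S T]

/-- D is full here: φ ↦ β(φ)(v) is a functional on DT, hence evaluation at a unique α(v), since T is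
finite over k. Linearity of α follows from uniqueness. -/
theorem exists_hom_of_dual [IsArtinianRing k] [Module.Finite k T]
    (β : Dual k T →ₗ[Sᵐᵒᵖ] Dual k V) : ∃ α : V →ₗ[S] T, ∀ v φ, β φ v = φ (α v) := by
  have h : ∀ v, ∃ t : T, ∀ φ : Dual k T, β φ v = φ t := fun v => by
    obtain ⟨t, ht⟩ := (Dual.eval_bijective (k := k) T).2
      (Dual.of (k := k) (V := Dual k T)
        { toFun := fun φ => β φ v
          map_add' := fun φ ψ => by rw [map_add, Dual.add_apply]
          map_smul' := fun c φ => by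
            rw [LinearMap.map_smul_of_tower, Dual.smul_apply, RingHom.id_apply] })
    exact ⟨t, fun φ => (DFunLike.congr_fun ht φ).symm⟩
  choose α hα using h
  have hinj : ∀ t t' : T, (∀ φ : Dual k T, φ t = φ t') → t = t' := fun t t' h =>
    Dual.eval_injective (k := k) (Dual.ext h)
  refine ⟨{ toFun := α, map_add' := fun v w => hinj _ _ fun φ => ?_,
            map_smul' := fun s v => hinj _ _ fun φ => ?_ }, hα⟩
  · rw [← hα, map_add, map_add, hα, hα]
  · rw [← hα, RingHom.id_apply]
    have h1 : φ (s • α v) = (op s • φ) (α v) := rfl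
    rw [h1, ← hα, map_smul β]
    rfl

end RightMap

/-! ### Functionals on M ⊗_S V -/

section BalancedDual

attribute [local instance] smulCommClass_op

variable {k S R V M : Type u} [CommRing k] [Ring S] [Algebra k S] [Ring R]
  [Algebra k R] [AddCommGroup V] [Module k V] [Module S V] [Module Rᵐᵒᵖ V] [IsScalarTower k S V]
  [IsScalarTower k Rᵐᵒᵖ V] [SMulCommClass S Rᵐᵒᵖ V] [AddCommGroup M] [Module Sᵐᵒᵖ M]

/-- Half of D(M ⊗_S V) ≅ Hom_S(M, DV). Coinduction replaces the functional by an R-map into DR, to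
which `BalancedTensor.lift` applies; evaluating at 1 recovers it. -/
theorem BalancedTensor.exists_dual (φ : M →ₗ[Sᵐᵒᵖ] Dual k V) :
    ∃ ξ : Dual k (BalancedTensor S R V M), ∀ m v, ξ (BalancedTensor.tmul S R v m) = φ m v := by
  let ψ : M →ₗ[Sᵐᵒᵖ] RightHom R V (Dual k R) :=
    { toFun := fun m => RightHom.of (Dual.coind R (φ m))
      map_add' := fun m n => by rw [map_add]; rfl
      map_smul' := fun s m => by
        rw [map_smul]
        refine RightHom.ext fun v => Dual.ext fun r => ?_
        change φ m (unop s • op r • v) = φ m (op r • unop s • v)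
        rw [smul_comm] }
  refine ⟨Dual.evalOne (BalancedTensor.lift ψ), fun m v => ?_⟩
  rw [Dual.evalOne_apply, BalancedTensor.lift_tmul]
  change φ m (op 1 • v) = φ m v
  rw [op_one, one_smul]

omit [Algebra k S] [IsScalarTower k S V] [SMulCommClass S Rᵐᵒᵖ V] in
theorem BalancedTensor.dual_ext {ξ ξ' : Dual k (BalancedTensor S R V M)}
    (h : ∀ v m, ξ (BalancedTensor.tmul S R v m) = ξ' (BalancedTensor.tmul S R v m)) : ξ = ξ' :=
  Dual.ext fun x => BalancedTensor.induction (p := fun x => ξ x = ξ' x) (by simp) h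
    (fun x y hx hy => by rw [map_add, map_add, hx, hy]) x

omit [SMulCommClass S Rᵐᵒᵖ V] in
-- D(M ⊗_S V) embeds in the finite module Hom_k(M, DV), and M ⊗_S V embeds in its double dual.
theorem BalancedTensor.finite [IsArtinianRing k] [Module k M] [IsScalarTower k Sᵐᵒᵖ M]
    [Module.Finite k M] [Module.Finite k V] : Module.Finite k (BalancedTensor S R V M) := by
  let Φ : Dual k (BalancedTensor S R V M) →ₗ[k] (M →ₗ[k] Dual k V) :=
    { toFun := fun ξ =>
        { toFun := fun m => Dual.of
            { toFun := fun v => ξ (BalancedTensor.tmul S R v m)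
              map_add' := fun v w => by rw [BalancedTensor.add_tmul, map_add]
              map_smul' := fun c v => by
                rw [RingHom.id_apply, ← map_smul]
                rfl }
          map_add' := fun m n => Dual.ext fun v => by
            rw [Dual.add_apply]
            exact (congrArg ξ (BalancedTensor.tmul_add v m n)).trans (map_add ξ _ _)
          map_smul' := fun c m => Dual.ext fun v => by
            have h1 : c • m = op (algebraMap k S c) • m := by
              rw [← smul_one_smul Sᵐᵒᵖ c m]
              congr 1
              rw [Algebra.algebraMap_eq_smul_one, op_smul, op_one]
            change ξ (BalancedTensor.tmul S R v (c • m)) = c • ξ (BalancedTensor.tmul S R v m)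
            rw [h1, ← BalancedTensor.smul_tmul, algebraMap_smul, ← map_smul]
            rfl }
      map_add' := fun _ _ => rfl
      map_smul' := fun _ _ => rfl }
  have hΦ : Function.Injective Φ := fun ξ ξ' h => BalancedTensor.dual_ext fun v m =>
    DFunLike.congr_fun (LinearMap.congr_fun h m) v
  have : Module.Finite k (Dual k (BalancedTensor S R V M)) := Module.Finite.of_injective Φ hΦ
  exact Module.Finite.of_injective _ (Dual.eval_injective (k := k))

end BalancedDual

/-! ### X ⊗_R DT ≅ D Hom_R(X, T), and reflexivity -/

section TensorDual

attribute [local instance] smulCommClass_op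

variable {k S R T X : Type u} [CommRing k] [Ring S] [Algebra k S] [Ring R]
  [Algebra k R] [AddCommGroup T] [Module k T] [Module S T] [Module Rᵐᵒᵖ T] [IsScalarTower k S T]
  [IsScalarTower k Rᵐᵒᵖ T] [SMulCommClass S Rᵐᵒᵖ T] [AddCommGroup X] [Module Rᵐᵒᵖ X]

variable (k S R T X) in
/-- The map `X → Hom_S(D T, D Hom_R(X, T))` given by evaluation. -/
noncomputable def evalHom : X →ₗ[Rᵐᵒᵖ] RightHom S (Dual k T) (Dual k (X →ₗ[Rᵐᵒᵖ] T)) where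
  toFun x := RightHom.of (R := S)
    { toFun := fun φ => Dual.of
        { toFun := fun f => φ (f x)
          map_add' := fun f g => by rw [LinearMap.add_apply, map_add]
          map_smul' := fun c f => by rw [LinearMap.smul_apply, map_smul, RingHom.id_apply] }
      map_add' := fun _ _ => rfl
      map_smul' := fun _ _ => rfl }
  map_add' x y := RightHom.ext fun φ => Dual.ext fun f =>
    (congrArg φ (map_add f x y)).trans (map_add φ _ _)
  map_smul' r x := RightHom.ext fun φ => Dual.ext fun f => congrArg φ (map_smul f r x)

@[simp] theorem evalHom_hom_apply (x : X) (φ : Dual k T) (f : X →ₗ[Rᵐᵒᵖ] T) :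
    (evalHom k S R T X x).hom φ f = φ (f x) := rfl

variable (k S R T X) in
/-- The map `X ⊗_R D T → D Hom_R(X, T)`. -/
noncomputable def tensorDualMap :
    BalancedTensor R S (Dual k T) X →ₗ[Sᵐᵒᵖ] Dual k (X →ₗ[Rᵐᵒᵖ] T) :=
  BalancedTensor.lift (evalHom k S R T X)

variable [IsArtinianRing k] [Module.Finite k T]

theorem finite_hom [Module k X] [IsScalarTower k Rᵐᵒᵖ X] [Module.Finite k X] :
    Module.Finite k (X →ₗ[Rᵐᵒᵖ] T) :=
  Module.Finite.of_injective (LinearMap.restrictScalarsₗ k Rᵐᵒᵖ X T k)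
    (LinearMap.restrictScalars_injective k)

/-- Both halves are tested on functionals. By reflexivity of T a functional on X ⊗_R DT has the form
φ ⊗ x ↦ φ(F x) with F : X → T linear, so it factors through the map. A functional on D Hom_R(X, T)
is evaluation at some f, and f = 0 if it kills the image. -/
theorem tensorDualMap_bijective [Module k X] [IsScalarTower k Rᵐᵒᵖ X] [Module.Finite k X] :
    Function.Bijective (tensorDualMap k S R T X) := by
  have := finite_hom (k := k) (R := R) (T := T) (X := X)
  constructor
  · refine (injective_iff_map_eq_zero _).2 fun y hy => Dual.eq_zero_of_forall (k := k) fun ξ => ?_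
    have h : ∀ x, ∃ t : T, ∀ φ : Dual k T, ξ (BalancedTensor.tmul R S φ x) = φ t := fun x => by
      obtain ⟨t, ht⟩ := (Dual.eval_bijective (k := k) T).2
        (Dual.of (k := k) (V := Dual k T)
          { toFun := fun φ => ξ (BalancedTensor.tmul R S φ x)
            map_add' := fun φ ψ => by rw [BalancedTensor.add_tmul, map_add]
            map_smul' := fun c φ => by
              rw [RingHom.id_apply, ← map_smul]
              rfl })
      exact ⟨t, fun φ => (DFunLike.congr_fun ht φ).symm⟩
    choose f hf using h
    have hinj : ∀ t t' : T, (∀ φ : Dual k T, φ t = φ t') → t = t' := fun t t' h =>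
      Dual.eval_injective (k := k) (Dual.ext h)
    let F : X →ₗ[Rᵐᵒᵖ] T :=
      { toFun := f
        map_add' := fun x y => hinj _ _ fun φ => by
          rw [← hf, BalancedTensor.tmul_add, map_add, map_add, hf, hf]
        map_smul' := fun r x => hinj _ _ fun φ => by
          have h1 : φ (r • f x) = (unop r • φ) (f x) := rfl
          rw [← hf, RingHom.id_apply, h1, ← hf, BalancedTensor.smul_tmul, op_unop] }
    have h2 : ξ = Dual.map ((tensorDualMap k S R T X).restrictScalars k)
        (Dual.eval k (X →ₗ[Rᵐᵒᵖ] T) F) := BalancedTensor.dual_ext fun φ x => hf x φ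
    rw [h2, Dual.map_apply, LinearMap.restrictScalars_apply, hy, map_zero]
  · refine Dual.surjective_of_forall (f := (tensorDualMap k S R T X).restrictScalars k)
      fun ζ hζ => ?_
    obtain ⟨f, rfl⟩ := (Dual.eval_bijective (k := k) (X →ₗ[Rᵐᵒᵖ] T)).2 ζ
    have h1 : f = 0 := LinearMap.ext fun x => Dual.eq_zero_of_forall fun φ =>
      hζ (BalancedTensor.tmul R S φ x)
    rw [h1, map_zero]

/-- If `X` is `T`-reflexive, then the unit `X → Hom_S(D T, X ⊗_R D T)` is bijective. -/
theorem unit_dual_bijective [Module k X] [IsScalarTower k Rᵐᵒᵖ X] [Module.Finite k X]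
    (hsep : ∀ x : X, x ≠ 0 → ∃ f : X →ₗ[Rᵐᵒᵖ] T, f x ≠ 0)
    (hrefl : ∀ α : (X →ₗ[Rᵐᵒᵖ] T) →ₗ[S] T, ∃ x, ∀ f, α f = f x) :
    Function.Bijective (BalancedTensor.unit R S (Dual k T) X) := by
  have hθ := tensorDualMap_bijective (k := k) (S := S) (R := R) (T := T) (X := X)
  have hcomp : ∀ x, RightHom.map (R := S) R (Dual k T) (tensorDualMap k S R T X)
      (BalancedTensor.unit R S (Dual k T) X x) = evalHom k S R T X x := fun x => rfl
  constructor
  · refine (injective_iff_map_eq_zero _).2 fun x hx => ?_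
    by_contra hne
    obtain ⟨f, hf⟩ := hsep x hne
    refine hf (Dual.eq_zero_of_forall (k := k) fun φ => ?_)
    have h1 := hcomp x
    rw [hx, map_zero] at h1
    exact (DFunLike.congr_fun (LinearMap.congr_fun (congrArg RightHom.hom h1) φ) f).symm
  · intro h
    -- Composed with the isomorphism to D Hom_R(X, T), h becomes the dual of some α : Hom_R(X, T) →
    -- T, which reflexivity turns into evaluation at a point of X.
    obtain ⟨α, hα⟩ := exists_hom_of_dual ((tensorDualMap k S R T X) ∘ₗ h.hom)
    obtain ⟨x, hx⟩ := hrefl α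
    refine ⟨x, RightHom.map_injective (S := R) (V := Dual k T) hθ.1 ?_⟩
    rw [hcomp]
    refine RightHom.ext fun φ => Dual.ext fun f => ?_
    rw [evalHom_hom_apply, ← hx]
    exact (hα f φ).symm

end TensorDual

/-! ### Restricting an adjunction to equivalences -/

section Equivalences

variable {C D : Type*} [Category* C] [Category* D] {F : C ⥤ D} {H : D ⥤ C} (adj : F ⊣ H)
include adj

/-- By a triangle identity the unit is invertible at H X whenever the counit is invertible at X;
naturality carries this to every object isomorphic to such an H X. -/
theorem restrictToEquivalence_of_isIso_counit (P : ObjectProperty D) [P.IsClosedUnderIsomorphisms]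
    (h : ∀ X, P X → IsIso (adj.counit.app X)) : RestrictToEquivalence H F P (P.map H) := by
  have hunit : ∀ Y, P.map H Y → IsIso (adj.unit.app Y) := by
    rintro Y ⟨X, hX, ⟨e⟩⟩
    have := h X hX
    have h1 : IsIso (adj.unit.app (H.obj X)) := by
      have h2 := adj.right_triangle_components X
      have : IsIso (adj.unit.app (H.obj X) ≫ H.map (adj.counit.app X)) := by rw [h2]; exact IsIso.id _
      exact IsIso.of_isIso_comp_right _ (H.map (adj.counit.app X))
    have h3 := adj.unit.naturality e.hom
    rw [Functor.id_map] at h3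
    have : IsIso (e.hom ≫ adj.unit.app Y) := by
      rw [h3]
      infer_instance
    exact IsIso.of_isIso_comp_left e.hom _
  refine ⟨fun X hX => ⟨X, hX, ⟨Iso.refl _⟩⟩, ?_, ⟨?_⟩, ⟨?_⟩⟩
  · rintro Y ⟨X, hX, ⟨e⟩⟩
    have := h X hX
    exact P.prop_of_iso ((asIso (adj.counit.app X)).symm ≪≫ F.mapIso e) hX
  · exact NatIso.ofComponents (fun X => haveI := h X.obj X.property
      P.isoMk (asIso (adj.counit.app X.obj))) (fun f => by
        ext
        exact adj.counit.naturality f.hom)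
  · refine Iso.symm (NatIso.ofComponents (fun Y => haveI := hunit Y.obj Y.property
      (P.map H).isoMk (asIso (adj.unit.app Y.obj))) (fun f => by
        ext
        exact adj.unit.naturality f.hom))

theorem restrictToEquivalence_of_isIso_unit (P : ObjectProperty C) [P.IsClosedUnderIsomorphisms]
    (h : ∀ X, P X → IsIso (adj.unit.app X)) : RestrictToEquivalence H F (P.map F) P := by
  have hcounit : ∀ Y, P.map F Y → IsIso (adj.counit.app Y) := by
    rintro Y ⟨X, hX, ⟨e⟩⟩
    have := h X hX
    have h1 : IsIso (adj.counit.app (F.obj X)) := by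
      have h2 := adj.left_triangle_components X
      have : IsIso (F.map (adj.unit.app X) ≫ adj.counit.app (F.obj X)) := by rw [h2]; exact IsIso.id _
      exact IsIso.of_isIso_comp_left (F.map (adj.unit.app X)) _
    have h3 := adj.counit.naturality e.hom
    rw [Functor.id_map] at h3
    have : IsIso ((H ⋙ F).map e.hom ≫ adj.counit.app Y) := by
      rw [h3]
      infer_instance
    exact IsIso.of_isIso_comp_left ((H ⋙ F).map e.hom) _
  refine ⟨?_, fun X hX => ⟨X, hX, ⟨Iso.refl _⟩⟩, ⟨?_⟩, ⟨?_⟩⟩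
  · rintro Y ⟨X, hX, ⟨e⟩⟩
    have := h X hX
    exact P.prop_of_iso (asIso (adj.unit.app X) ≪≫ H.mapIso e) hX
  · exact NatIso.ofComponents (fun Y => haveI := hcounit Y.obj Y.property
      (P.map F).isoMk (asIso (adj.counit.app Y.obj))) (fun f => by
        ext
        exact adj.counit.naturality f.hom)
  · refine Iso.symm (NatIso.ofComponents (fun X => haveI := h X.obj X.property
      P.isoMk (asIso (adj.unit.app X.obj))) (fun f => by
        ext
        exact adj.unit.naturality f.hom))

end Equivalences


/-! ### Two elementary facts about linear maps -/

section Auxiliary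

theorem Dual.sum_apply {ι : Type*} {k V : Type u} [CommRing k] [AddCommGroup V] [Module k V] (s : Finset ι)
    (φ : ι → Dual k V) (v : V) : (∑ i ∈ s, φ i) v = ∑ i ∈ s, φ i v :=
  map_sum (⟨⟨fun φ : Dual k V => φ v, rfl⟩, fun _ _ => rfl⟩ : Dual k V →+ MinInjCogenerator k) φ s

variable {Λ X Y Z : Type*} [Ring Λ] [AddCommGroup X] [Module Λ X] [AddCommGroup Y] [Module Λ Y]
  [AddCommGroup Z] [Module Λ Z]

theorem exists_factor_of_surjective {q : X →ₗ[Λ] Y} (hq : Function.Surjective q) (f : X →ₗ[Λ] Z)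
    (hf : ∀ x, q x = 0 → f x = 0) : ∃ g : Y →ₗ[Λ] Z, ∀ x, g (q x) = f x := by
  let e := q.quotKerEquivOfSurjective hq
  refine ⟨(LinearMap.ker q).liftQ f hf ∘ₗ e.symm.toLinearMap, fun x => ?_⟩
  have h : e.symm (q x) = (LinearMap.ker q).mkQ x := by
    rw [LinearEquiv.symm_apply_eq]
    rfl
  rw [LinearMap.comp_apply, LinearEquiv.coe_coe, h]
  rfl

end Auxiliary

/-! ### Cotorsion pairs and hereditary presentations -/

section Cotorsion

variable {Λ : Type u} [Ring Λ] {B A : ObjectProperty (ModuleCat.{u} Λ)} (h : IsCotorsionPair B A)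
include h

theorem IsCotorsionPair.extVanishes {X Y : Type u} [AddCommGroup X] [Module Λ X] [AddCommGroup Y]
    [Module Λ Y] (hX : B (ModuleCat.of Λ X)) (hY : A (ModuleCat.of Λ Y)) : ExtVanishes Λ X Y :=
  ((h.left_iff _).1 hX).2 _ hY

theorem IsCotorsionPair.isClosedUnderIsomorphisms_left : B.IsClosedUnderIsomorphisms where
  of_iso {X Y} e hX := by
    obtain ⟨hfin, hext⟩ := (h.left_iff X).1 hX
    exact (h.left_iff Y).2 ⟨Module.Finite.equiv e.toLinearEquiv,
      fun Z hZ => subsingleton_ext_of_retract_left (Retract.ofIso e.symm) (hext Z hZ)⟩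

theorem IsCotorsionPair.isClosedUnderIsomorphisms_right : A.IsClosedUnderIsomorphisms where
  of_iso {X Y} e hX := by
    obtain ⟨hfin, hext⟩ := (h.right_iff X).1 hX
    exact (h.right_iff Y).2 ⟨Module.Finite.equiv e.toLinearEquiv,
      fun Z hZ => subsingleton_ext_of_retract_right (Retract.ofIso e.symm) (hext Z hZ)⟩

end Cotorsion

section Presentation

variable {Λ : Type u} [Ring Λ] [IsNoetherianRing Λ] {B A : ObjectProperty (ModuleCat.{u} Λ)}
  (h : IsHereditaryCotorsionPair B A)
include h

theorem IsHereditaryCotorsionPair.exists_presentation {X : Type u} [AddCommGroup X] [Module Λ X]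
    (hX : B (ModuleCat.of Λ X)) : ∃ (n : ℕ) (p : (Fin n → Λ) →ₗ[Λ] X), Function.Surjective p ∧
      B (ModuleCat.of Λ (LinearMap.ker p)) := by
  have : Module.Finite Λ X := h.isResolving.finite _ hX
  obtain ⟨n, p, hp⟩ := Module.Finite.exists_fin' Λ X
  refine ⟨n, p, hp, ?_⟩
  refine h.isResolving.kernels _ (shortExact_of_exact (LinearMap.ker p).injective_subtype
    (LinearMap.exact_subtype_ker_map p) hp) ?_ ?_ hX
  · exact inferInstanceAs (Module.Finite Λ (LinearMap.ker p))
  · exact h.isResolving.projective _ (inferInstanceAs (Module.Finite Λ (Fin n → Λ)))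
      (inferInstanceAs (Module.Projective Λ (Fin n → Λ)))

/-- A is closed under cokernels of monomorphisms. With 0 → N → F → X → 0 and N in B, a map N → Z
lifts to I as Ext¹(N, Y) = 0, then extends to F as Ext¹(X, I) = 0. -/
theorem IsHereditaryCotorsionPair.mem_of_exact {Y I Z : Type u} [AddCommGroup Y] [Module Λ Y]
    [AddCommGroup I] [Module Λ I] [AddCommGroup Z] [Module Λ Z] {f : Y →ₗ[Λ] I} {g : I →ₗ[Λ] Z}
    (hf : Function.Injective f) (hfg : Function.Exact f g) (hg : Function.Surjective g)
    (hY : A (ModuleCat.of Λ Y)) (hI : A (ModuleCat.of Λ I)) : A (ModuleCat.of Λ Z) := by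
  have : Module.Finite Λ I := ((h.isCotorsionPair.right_iff _).1 hI).1
  refine (h.isCotorsionPair.right_iff _).2 ⟨Module.Finite.of_surjective g hg, fun X hX => ?_⟩
  obtain ⟨n, p, hp, hN⟩ := h.exists_presentation hX
  refine ExtVanishes.of_extension (LinearMap.ker p).injective_subtype
    (LinearMap.exact_subtype_ker_map p) hp extVanishes_of_projective fun φ => ?_
  obtain ⟨ψ, hψ⟩ := (h.isCotorsionPair.extVanishes hN hY).exists_lift hf hfg hg φ
  obtain ⟨χ, hχ⟩ := (h.isCotorsionPair.extVanishes hX hI).exists_extension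
    (LinearMap.ker p).injective_subtype (LinearMap.exact_subtype_ker_map p) hp ψ
  exact ⟨g ∘ₗ χ, fun x => by rw [LinearMap.comp_apply, hχ, hψ]⟩

end Presentation

/-! ### The composition pairing between B and A -/

section Generator

attribute [local instance] smulCommClass_op

variable {k S R T : Type u} [CommRing k] [Ring S] [Algebra k S] [Ring R]
  [Algebra k R] [AddCommGroup T] [Module k T] [Module S T] [Module Rᵐᵒᵖ T] [IsScalarTower k S T]
  [IsScalarTower k Rᵐᵒᵖ T] [SMulCommClass S Rᵐᵒᵖ T]
  {B A : ObjectProperty (ModuleCat.{u} Rᵐᵒᵖ)}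
  {X Y : Type u} [AddCommGroup X] [Module Rᵐᵒᵖ X] [AddCommGroup Y] [Module Rᵐᵒᵖ Y]

omit [SMulCommClass S Rᵐᵒᵖ T] in
-- Unpacks T₀ in add T into coordinate maps with ∑ rⱼ iⱼ = 1, the form in which the splitting is
-- used.
theorem IsExtProjectiveGenerator.exists_exact (hgen : IsExtProjectiveGenerator T A)
    (hY : A (ModuleCat.of Rᵐᵒᵖ Y)) :
    ∃ (Y' T₀ : Type u) (_ : AddCommGroup Y') (_ : Module Rᵐᵒᵖ Y') (_ : AddCommGroup T₀)
      (_ : Module Rᵐᵒᵖ T₀) (ι : Y' →ₗ[Rᵐᵒᵖ] T₀) (π : T₀ →ₗ[Rᵐᵒᵖ] Y) (n : ℕ)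
      (i : Fin n → T₀ →ₗ[Rᵐᵒᵖ] T) (r : Fin n → T →ₗ[Rᵐᵒᵖ] T₀),
      A (ModuleCat.of Rᵐᵒᵖ Y') ∧ Function.Injective ι ∧ Function.Exact ι π ∧
        Function.Surjective π ∧ ∑ j, r j ∘ₗ i j = LinearMap.id := by
  obtain ⟨Y', T₀, f, g, w, hY', ⟨n, ⟨ρ⟩⟩, hfg⟩ := hgen.generator _ hY
  have h1 := hfg.mono_f
  have h2 := hfg.epi_g
  refine ⟨Y', T₀, inferInstance, inferInstance, inferInstance, inferInstance, f.hom, g.hom, n,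
    fun j => LinearMap.proj j ∘ₗ ρ.i.hom, fun j => ρ.r.hom ∘ₗ LinearMap.single Rᵐᵒᵖ (fun _ : Fin n => T) j, hY',
    (ModuleCat.mono_iff_injective f).1 h1,
    (ShortComplex.ShortExact.moduleCat_exact_iff_function_exact _).1 hfg.exact,
    (ModuleCat.epi_iff_surjective g).1 h2, LinearMap.ext fun t => ?_⟩
  have h3 : ρ.r.hom (ρ.i.hom t) = t := congrArg (fun q => q.hom t) ρ.retract
  conv_rhs => rw [LinearMap.id_apply, ← h3, ← LinearMap.sum_single_apply _ (ρ.i.hom t), map_sum]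
  rw [LinearMap.sum_apply]
  rfl

/-- Ext¹(X, Y') = 0 lifts h to T₀, and the identity of T₀ is a sum of maps through T. -/
theorem exists_sum_comp_eq (hBA : IsCotorsionPair B A) (hgen : IsExtProjectiveGenerator T A)
    (hX : B (ModuleCat.of Rᵐᵒᵖ X)) (hY : A (ModuleCat.of Rᵐᵒᵖ Y)) (h : X →ₗ[Rᵐᵒᵖ] Y) :
    ∃ (n : ℕ) (g : Fin n → T →ₗ[Rᵐᵒᵖ] Y) (f : Fin n → X →ₗ[Rᵐᵒᵖ] T), h = ∑ j, g j ∘ₗ f j := by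
  obtain ⟨Y', T₀, _, _, _, _, ι, π, n, i, r, hY', hι, hex, hπ, hid⟩ := hgen.exists_exact hY
  obtain ⟨h', hh'⟩ := (hBA.extVanishes hX hY').exists_lift hι hex hπ h
  refine ⟨n, fun j => π ∘ₗ r j, fun j => i j ∘ₗ h', LinearMap.ext fun x => ?_⟩
  rw [← hh', LinearMap.sum_apply]
  conv_lhs => rw [← LinearMap.id_apply (R := Rᵐᵒᵖ) (h' x), ← hid, LinearMap.sum_apply, map_sum]
  rfl

variable [Module k Y] [IsScalarTower k Rᵐᵒᵖ Y]

/-- Surjectivity of D Hom_R(X, Y) → Hom_S(Hom_R(T, Y), D Hom_R(X, T)). The functional is written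
down on Hom_R(X, T₀), where the splitting of T₀ dictates it, and then descends along Hom_R(X, T₀) →
Hom_R(X, Y). -/
theorem exists_dual_pairing_eq [IsArtinianRing k]
    (hS : Function.Surjective (Module.toModuleEnd Rᵐᵒᵖ T : S →+* Module.End Rᵐᵒᵖ T))
    (hBA : IsCotorsionPair B A)
    (hgen : IsExtProjectiveGenerator T A) (hX : B (ModuleCat.of Rᵐᵒᵖ X))
    (hY : A (ModuleCat.of Rᵐᵒᵖ Y)) (β : RightHom R T Y →ₗ[Sᵐᵒᵖ] Dual k (X →ₗ[Rᵐᵒᵖ] T)) :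
    ∃ ξ : Dual k (X →ₗ[Rᵐᵒᵖ] Y), ∀ g f, β g f = ξ (g.hom ∘ₗ f) := by
  obtain ⟨Y', T₀, _, _, _, _, ι, π, n, i, r, hY', hι, hex, hπ, hid⟩ := hgen.exists_exact hY
  let := Module.restrictScalars k Rᵐᵒᵖ Y'
  let := Module.restrictScalars k Rᵐᵒᵖ T₀
  have := IsScalarTower.restrictScalars k Rᵐᵒᵖ Y'
  have := IsScalarTower.restrictScalars k Rᵐᵒᵖ T₀
  let ξ₀ : Dual k (X →ₗ[Rᵐᵒᵖ] T₀) :=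
    ∑ j, Dual.map (LinearMap.compRight k (i j)) (β (RightHom.of (π ∘ₗ r j)))
  have hξ₀ : ∀ (g : T →ₗ[Rᵐᵒᵖ] T₀) (f : X →ₗ[Rᵐᵒᵖ] T),
      ξ₀ (g ∘ₗ f) = β (RightHom.of (π ∘ₗ g)) f := by
    intro g f
    have h1 : RightHom.of (π ∘ₗ g) = ∑ j, RightHom.of (π ∘ₗ r j ∘ₗ i j ∘ₗ g) := by
      rw [← RightHom.of_sum]
      refine RightHom.ext fun t => ?_
      change π (g t) = (∑ j, π ∘ₗ r j ∘ₗ i j ∘ₗ g) t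
      conv_lhs =>
        rw [← LinearMap.id_apply (R := Rᵐᵒᵖ) (g t), ← hid, LinearMap.sum_apply, map_sum]
      rw [LinearMap.sum_apply]
      rfl
    rw [h1, map_sum, Dual.sum_apply, Dual.sum_apply]
    refine Finset.sum_congr rfl fun j _ => ?_
    -- The endomorphism iⱼ g of T is multiplication by some s, which S-linearity of β moves from one
    -- argument to the other.
    obtain ⟨s, hs⟩ := hS (i j ∘ₗ g)
    have h2 : ∀ t, i j (g t) = s • t := fun t => (LinearMap.congr_fun hs t).symm
    have h3 : i j ∘ₗ g ∘ₗ f = s • f := LinearMap.ext fun x => h2 (f x)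
    have h4 : RightHom.of (π ∘ₗ r j ∘ₗ i j ∘ₗ g) = op s • RightHom.of (π ∘ₗ r j) :=
      RightHom.ext fun t => congrArg (fun t => π (r j t)) (h2 t)
    rw [h4, map_smul β]
    exact congrArg (β (RightHom.of (π ∘ₗ r j))) h3
  have hex' : Function.Exact (LinearMap.compRight k (M := X) ι) (LinearMap.compRight k (M := X) π) := by
    intro h
    constructor
    · intro hh
      exact exists_comp_eq_of_exact hι hex h hh
    · rintro ⟨h', rfl⟩
      exact LinearMap.ext fun x => hex.apply_apply_eq_zero _
  -- Maps X → Y' are sums of maps through T as well, and on those ξ₀ is computed by β at π ∘ ι ∘ g =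
  -- 0.
  have h0 : Dual.map (LinearMap.compRight k (M := X) ι) ξ₀ = 0 := by
    refine Dual.ext fun h => ?_
    obtain ⟨m, g, f, rfl⟩ := exists_sum_comp_eq hBA hgen hX hY' h
    rw [map_sum, Dual.zero_apply]
    refine Finset.sum_eq_zero fun j _ => ?_
    have h1 : π ∘ₗ ι ∘ₗ g j = 0 := LinearMap.ext fun t => hex.apply_apply_eq_zero _
    have h2 := hξ₀ (ι ∘ₗ g j) (f j)
    rw [h1, RightHom.of_zero, map_zero, Dual.zero_apply] at h2
    exact h2
  obtain ⟨ξ, hξ⟩ := (Dual.exact_map hex' ξ₀).1 h0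
  refine ⟨ξ, fun g f => ?_⟩
  have hext : ExtVanishes Rᵐᵒᵖ T Y' := hgen.extProjective _ hY'
  obtain ⟨g', hg'⟩ := hext.exists_lift hι hex hπ g.hom
  have h1 : g = RightHom.of (π ∘ₗ g') := RightHom.ext fun t => (hg' t).symm
  rw [h1, ← hξ₀, ← hξ]
  rfl

/-- Since End(T_R) ≅ S, the coordinates g ↦ iⱼ g exhibit Hom_R(T, T₀) as a retract of Sⁿ. -/
theorem projective_rightHom {T₀ : Type u} [AddCommGroup T₀] [Module Rᵐᵒᵖ T₀]
    (hS : Function.Bijective (Module.toModuleEnd Rᵐᵒᵖ T : S →+* Module.End Rᵐᵒᵖ T)) {n : ℕ}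
    (i : Fin n → T₀ →ₗ[Rᵐᵒᵖ] T) (r : Fin n → T →ₗ[Rᵐᵒᵖ] T₀)
    (hid : ∑ j, r j ∘ₗ i j = LinearMap.id) :
    Module.Projective Sᵐᵒᵖ (RightHom R T T₀) := by
  let e := RingEquiv.ofBijective _ hS
  have he : ∀ (φ : Module.End Rᵐᵒᵖ T) (t : T), e.symm φ • t = φ t := fun φ t =>
    LinearMap.congr_fun (e.apply_symm_apply φ) t
  refine Module.Projective.of_split (M := Fin n → Sᵐᵒᵖ)
    { toFun := fun g j => op (e.symm (i j ∘ₗ g.hom))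
      map_add' := fun g g' => funext fun j => by
        rw [RightHom.hom_add, LinearMap.comp_add, map_add]
        rfl
      map_smul' := fun s g => funext fun j => by
        refine unop_injective ((e.symm_apply_eq).2 (LinearMap.ext fun t => ?_))
        change i j (g.hom (unop s • t)) = (e.symm (i j ∘ₗ g.hom) * unop s) • t
        rw [mul_smul, he]
        rfl }
    { toFun := fun s => ∑ j, s j • RightHom.of (r j)
      map_add' := fun s s' => by
        rw [← Finset.sum_add_distrib]
        exact Finset.sum_congr rfl fun j _ => add_smul _ _ _
      map_smul' := fun s s' => by
        rw [RingHom.id_apply, Finset.smul_sum]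
        exact Finset.sum_congr rfl fun j _ => mul_smul _ _ _ }
    (LinearMap.ext fun g => ?_)
  have h1 : ∀ j, op (e.symm (i j ∘ₗ g.hom)) • RightHom.of (r j) =
      RightHom.of (r j ∘ₗ i j ∘ₗ g.hom) := fun j =>
    RightHom.ext fun t => congrArg (r j) (he _ t)
  change ∑ j, op (e.symm (i j ∘ₗ g.hom)) • RightHom.of (r j) = g
  rw [Finset.sum_congr rfl fun j _ => h1 j, ← RightHom.of_sum]
  refine RightHom.ext fun t => ?_
  conv_rhs => rw [← LinearMap.id_apply (R := Rᵐᵒᵖ) (g.hom t), ← hid, LinearMap.sum_apply]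
  rw [RightHom.hom_of, LinearMap.sum_apply]
  rfl

end Generator


section OppositeFinite

variable (k R : Type u) [CommRing k] [Ring R] [Algebra k R] [Module.Finite k R]

theorem isNoetherianRing_mulOpposite [IsArtinianRing k] : IsNoetherianRing Rᵐᵒᵖ :=
  IsNoetherianRing.of_finite k Rᵐᵒᵖ

end OppositeFinite

/-! ### Functionals regarded as S-homomorphisms -/

section Pairing

attribute [local instance] smulCommClass_op

variable {k S R T : Type u} [CommRing k] [Ring S] [Algebra k S] [Ring R]
  [Algebra k R] [AddCommGroup T] [Module k T] [Module S T] [Module Rᵐᵒᵖ T] [IsScalarTower k S T]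
  [IsScalarTower k Rᵐᵒᵖ T] [SMulCommClass S Rᵐᵒᵖ T]
  {X Y : Type u} [AddCommGroup X] [Module Rᵐᵒᵖ X] [AddCommGroup Y] [Module Rᵐᵒᵖ Y]
  [Module k Y] [IsScalarTower k Rᵐᵒᵖ Y]

variable (S T) in
/-- A functional on `Hom_R(X, Y)` pairs `Hom_R(T, Y)` with `Hom_R(X, T)` through composition. -/
noncomputable def compPairing (ξ : Dual k (X →ₗ[Rᵐᵒᵖ] Y)) :
    RightHom R T Y →ₗ[Sᵐᵒᵖ] Dual k (X →ₗ[Rᵐᵒᵖ] T) where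
  toFun g := Dual.map (LinearMap.compRight k g.hom) ξ
  map_add' g g' := Dual.ext fun f => by
    rw [Dual.add_apply, Dual.map_apply, Dual.map_apply, Dual.map_apply, ← map_add]
    rfl
  map_smul' s g := Dual.ext fun f => rfl

/-- The pairing of `M` and `V` given by a functional on `M ⊗_S V`. -/
noncomputable def BalancedTensor.dualHom {M : Type u} [AddCommGroup M] [Module Sᵐᵒᵖ M]
    (ξ : Dual k (BalancedTensor S R T M)) : M →ₗ[Sᵐᵒᵖ] Dual k T where
  toFun m := Dual.of
    { toFun := fun v => ξ (BalancedTensor.tmul S R v m)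
      map_add' := fun v w => by rw [BalancedTensor.add_tmul, map_add]
      map_smul' := fun c v => by
        rw [RingHom.id_apply, ← map_smul]
        rfl }
  map_add' m n := Dual.ext fun v =>
    (congrArg ξ (BalancedTensor.tmul_add v m n)).trans (map_add ξ _ _)
  map_smul' s m := Dual.ext fun v =>
    congrArg ξ (BalancedTensor.smul_tmul (unop s) v m).symm

omit [SMulCommClass S Rᵐᵒᵖ T] in
@[simp] theorem BalancedTensor.dualHom_apply {M : Type u} [AddCommGroup M] [Module Sᵐᵒᵖ M]
    (ξ : Dual k (BalancedTensor S R T M)) (m : M) (t : T) :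
    BalancedTensor.dualHom ξ m t = ξ (BalancedTensor.tmul S R t m) := rfl

end Pairing

/-! ### Orthogonality, counit on A, reflexivity on B -/

section Members

attribute [local instance] smulCommClass_op

variable {k S R T : Type u} [CommRing k] [IsArtinianRing k] [Ring S] [Algebra k S] [Ring R]
  [Algebra k R] [AddCommGroup T] [Module k T] [Module S T] [Module Rᵐᵒᵖ T] [IsScalarTower k S T]
  [IsScalarTower k Rᵐᵒᵖ T] [SMulCommClass S Rᵐᵒᵖ T]
  {B A : ObjectProperty (ModuleCat.{u} Rᵐᵒᵖ)}
  {X Y : Type u} [AddCommGroup X] [Module Rᵐᵒᵖ X] [AddCommGroup Y] [Module Rᵐᵒᵖ Y]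
  (hS : Function.Bijective (Module.toModuleEnd Rᵐᵒᵖ T : S →+* Module.End Rᵐᵒᵖ T))
  (hBA : IsHereditaryCotorsionPair B A) (hgen : IsExtProjectiveGenerator T A)

include hBA in
theorem IsHereditaryCotorsionPair.self_mem : B (ModuleCat.of Rᵐᵒᵖ Rᵐᵒᵖ) :=
  hBA.isResolving.projective _ (inferInstanceAs (Module.Finite Rᵐᵒᵖ Rᵐᵒᵖ))
    (inferInstanceAs (Module.Projective Rᵐᵒᵖ Rᵐᵒᵖ))

include hBA in
theorem IsHereditaryCotorsionPair.pi_dual_mem [Module.Finite k R] (n : ℕ) :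
    A (ModuleCat.of Rᵐᵒᵖ (Fin n → Dual k R)) := by
  have : Module.Finite Rᵐᵒᵖ (Fin n → Dual k R) := Module.Finite.of_restrictScalars_finite k _ _
  exact (hBA.isCotorsionPair.right_iff _).2 ⟨this, fun X _ => extVanishes_of_injective (X := X)⟩

include hBA in
theorem IsHereditaryCotorsionPair.dual_mem [Module.Finite k R] :
    A (ModuleCat.of Rᵐᵒᵖ (Dual k R)) := by
  have : Module.Finite Rᵐᵒᵖ (Dual k R) := Module.Finite.of_restrictScalars_finite k _ _
  exact (hBA.isCotorsionPair.right_iff _).2 ⟨this, fun X _ => extVanishes_of_injective (X := X)⟩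

include hBA hgen in
omit [Module k T] [IsScalarTower k Rᵐᵒᵖ T] in
-- T cogenerates B: a functional nonzero at x gives a map X → DR nonzero at x, and since DR is in A
-- this map is a sum of maps through T.
theorem exists_hom_apply_ne_zero [Module.Finite k R] [Module k X] [IsScalarTower k Rᵐᵒᵖ X]
    (hX : B (ModuleCat.of Rᵐᵒᵖ X)) {x : X} (hx : x ≠ 0) : ∃ f : X →ₗ[Rᵐᵒᵖ] T, f x ≠ 0 := by
  obtain ⟨φ, hφ⟩ := Dual.exists_apply_ne_zero (k := k) hx
  obtain ⟨n, g, f, h⟩ := exists_sum_comp_eq hBA.isCotorsionPair hgen hX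
    (hBA.dual_mem (k := k)) (Dual.coind R φ)
  by_contra! h0
  refine hφ ?_
  have h1 : Dual.coind R φ x = 0 := by
    rw [h, LinearMap.sum_apply]
    exact Finset.sum_eq_zero fun j _ => by rw [LinearMap.comp_apply, h0, map_zero]
  have h2 := DFunLike.congr_fun h1 1
  rwa [Dual.coind_apply, op_one, one_smul] at h2

include hS hBA hgen

/-- Hom_R(T, T₀) is projective, so it suffices to extend maps from Hom_R(T, Y'). Such a map is a
functional on Hom_R(X, Y'), which extends to Hom_R(X, T₀). -/
theorem extVanishes_rightHom_dual (hX : B (ModuleCat.of Rᵐᵒᵖ X)) (hY : A (ModuleCat.of Rᵐᵒᵖ Y)) :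
    ExtVanishes Sᵐᵒᵖ (RightHom R T Y) (Dual k (X →ₗ[Rᵐᵒᵖ] T)) := by
  obtain ⟨Y', T₀, _, _, _, _, ι, π, n, i, r, hY', hι, hex, hπ, hid⟩ := hgen.exists_exact hY
  let := Module.restrictScalars k Rᵐᵒᵖ Y'
  let := Module.restrictScalars k Rᵐᵒᵖ T₀
  have := IsScalarTower.restrictScalars k Rᵐᵒᵖ Y'
  have := IsScalarTower.restrictScalars k Rᵐᵒᵖ T₀
  have := projective_rightHom hS i r hid
  have hext : ExtVanishes Rᵐᵒᵖ T Y' := hgen.extProjective _ hY'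
  refine ExtVanishes.of_extension (RightHom.map_injective (S := S) (V := T) hι)
    (RightHom.map_exact hι hex) (fun g => ?_) extVanishes_of_projective fun φ => ?_
  · obtain ⟨g', hg'⟩ := hext.exists_lift hι hex hπ g.hom
    exact ⟨RightHom.of g', RightHom.ext hg'⟩
  · obtain ⟨ξ, hξ⟩ := exists_dual_pairing_eq hS.2 hBA.isCotorsionPair hgen hX hY' φ
    obtain ⟨ξ', rfl⟩ := Dual.map_surjective (f := LinearMap.compRight k (M := X) ι)
      (fun f g h => LinearMap.ext fun x => hι (LinearMap.congr_fun h x)) ξ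
    exact ⟨compPairing S T ξ', fun g => Dual.ext fun f => (hξ g f).symm⟩

/-- The composition pairing at X = R, with Hom_R(R, T) = T and Hom_R(R, Y) = Y: every functional on
Hom_R(T, Y) ⊗_S T factors through the counit, which gives injectivity. -/
theorem lift_id_bijective [Module k Y] [IsScalarTower k Rᵐᵒᵖ Y] (hY : A (ModuleCat.of Rᵐᵒᵖ Y)) :
    Function.Bijective (BalancedTensor.lift (LinearMap.id (R := Sᵐᵒᵖ) (M := RightHom R T Y))) := by
  constructor
  · refine (injective_iff_map_eq_zero _).2 fun y hy => Dual.eq_zero_of_forall (k := k) fun ξ => ?_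
    let ev : (Rᵐᵒᵖ →ₗ[Rᵐᵒᵖ] T) →ₗ[S] T := LinearMap.applyₗ' S (1 : Rᵐᵒᵖ)
    obtain ⟨ξ', hξ'⟩ := exists_dual_pairing_eq hS.2 hBA.isCotorsionPair hgen hBA.self_mem hY
      (Dual.rightMap k ev ∘ₗ BalancedTensor.dualHom ξ)
    let η : Dual k Y := Dual.map (LinearMap.ringLmapEquivSelf Rᵐᵒᵖ k Y).symm.toLinearMap ξ'
    have h1 : ξ = Dual.map ((BalancedTensor.lift (LinearMap.id (R := Sᵐᵒᵖ)
        (M := RightHom R T Y))).restrictScalars k) η := by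
      refine BalancedTensor.dual_ext fun t g => ?_
      have h2 := hξ' g (LinearMap.toSpanSingleton Rᵐᵒᵖ T t)
      have h3 : ev (LinearMap.toSpanSingleton Rᵐᵒᵖ T t) = t := one_smul Rᵐᵒᵖ t
      rw [LinearMap.comp_apply, Dual.rightMap_apply, h3, BalancedTensor.dualHom_apply] at h2
      rw [h2]
      refine congrArg ξ' (LinearMap.ext_ring ?_)
      simp
    rw [h1, Dual.map_apply, LinearMap.restrictScalars_apply, hy, map_zero]
  · intro y
    obtain ⟨n, g, f, h⟩ := exists_sum_comp_eq hBA.isCotorsionPair hgen hBA.self_mem hY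
      (LinearMap.toSpanSingleton Rᵐᵒᵖ Y y)
    refine ⟨∑ j, BalancedTensor.tmul S R (f j 1) (RightHom.of (g j)), ?_⟩
    have h1 := LinearMap.congr_fun h 1
    rw [LinearMap.toSpanSingleton_apply, one_smul, LinearMap.sum_apply] at h1
    rw [map_sum, h1]
    rfl

variable [Module.Finite k R]

omit hS in
-- Generators of Hom_R(X, T) over S form a left add T-approximation X → Tⁿ. It is injective because
-- T cogenerates B. Its cokernel is in B because any X → Y with Y in A is a sum of maps through T,
-- hence extends to Tⁿ.
theorem exists_coresolution [Module k X] [IsScalarTower k Rᵐᵒᵖ X] [Module.Finite k X]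
    [Module.Finite k T] (hX : B (ModuleCat.of Rᵐᵒᵖ X)) :
    ∃ (n : ℕ) (ι : X →ₗ[Rᵐᵒᵖ] (Fin n → T)), B (ModuleCat.of Rᵐᵒᵖ ((Fin n → T) ⧸ LinearMap.range ι)) ∧
      Function.Injective ι ∧ ∀ f : X →ₗ[Rᵐᵒᵖ] T, ∃ s : Fin n → S, ∀ x, f x = ∑ j, s j • ι x j := by
  have := finite_hom (k := k) (R := R) (T := T) (X := X)
  have : Module.Finite S (X →ₗ[Rᵐᵒᵖ] T) := Module.Finite.of_restrictScalars_finite k _ _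
  obtain ⟨n, b, hb⟩ := Module.Finite.exists_fin (R := S) (M := X →ₗ[Rᵐᵒᵖ] T)
  have hgenb : ∀ f : X →ₗ[Rᵐᵒᵖ] T, ∃ s : Fin n → S, ∀ x, f x = ∑ j, s j • b j x := fun f => by
    have h1 : f ∈ Submodule.span S (Set.range b) := hb ▸ Submodule.mem_top
    obtain ⟨s, rfl⟩ := (Submodule.mem_span_range_iff_exists_fun S).1 h1
    exact ⟨s, fun x => by rw [LinearMap.sum_apply]; rfl⟩
  have hinj : Function.Injective (LinearMap.pi b) := by
    refine (injective_iff_map_eq_zero _).2 fun x hx => ?_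
    by_contra hne
    obtain ⟨f, hf⟩ := exists_hom_apply_ne_zero (k := k) hBA hgen hX hne
    obtain ⟨s, hs⟩ := hgenb f
    refine hf ?_
    rw [hs]
    refine Finset.sum_eq_zero fun j _ => ?_
    have h2 : b j x = 0 := congrFun hx j
    rw [h2, smul_zero]
  refine ⟨n, LinearMap.pi b, ?_, hinj, hgenb⟩
  have : Module.Finite Rᵐᵒᵖ T := ((hBA.isCotorsionPair.right_iff _).1 hgen.mem).1
  refine (hBA.isCotorsionPair.left_iff _).2 ⟨inferInstanceAs (Module.Finite Rᵐᵒᵖ (_ ⧸ _)),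
    fun Y hY => ?_⟩
  have hext : ExtVanishes Rᵐᵒᵖ T Y := hgen.extProjective _ hY
  refine ExtVanishes.of_extension (f := LinearMap.pi b) (g := (LinearMap.range (LinearMap.pi b)).mkQ)
    hinj (LinearMap.exact_map_mkQ_range _) (Submodule.mkQ_surjective _)
    (hext.pi_left n) fun φ => ?_
  obtain ⟨m, g, f, rfl⟩ := exists_sum_comp_eq hBA.isCotorsionPair hgen hX hY φ
  choose s hs using fun j => hgenb (f j)
  refine ⟨∑ j, g j ∘ₗ ∑ i, s j i • LinearMap.proj i, fun x => ?_⟩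
  rw [LinearMap.sum_apply, LinearMap.sum_apply]
  refine Finset.sum_congr rfl fun j _ => ?_
  rw [LinearMap.comp_apply, LinearMap.comp_apply, hs, LinearMap.sum_apply]
  rfl

theorem exists_eval_eq [Module k X] [IsScalarTower k Rᵐᵒᵖ X] [Module.Finite k X]
    [Module.Finite k T] (hX : B (ModuleCat.of Rᵐᵒᵖ X)) (α : (X →ₗ[Rᵐᵒᵖ] T) →ₗ[S] T) :
    ∃ x, ∀ f, α f = f x := by
  obtain ⟨n, ι, hC, hι, hgenι⟩ := exists_coresolution (k := k) (S := S) hBA hgen hX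
  -- If α is evaluation at x, then t = ι x; so it is enough to put t in the image of ι.
  let t : Fin n → T := fun j => α (LinearMap.proj j ∘ₗ ι)
  have hα : ∀ (f : X →ₗ[Rᵐᵒᵖ] T) (s : Fin n → S), (∀ x, f x = ∑ j, s j • ι x j) →
      α f = ∑ j, s j • t j := fun f s hs => by
    have h1 : f = ∑ j, s j • (LinearMap.proj j ∘ₗ ι) := LinearMap.ext fun x => by
      rw [hs, LinearMap.sum_apply]
      rfl
    rw [h1, map_sum]
    exact Finset.sum_congr rfl fun j _ => map_smul α _ _
  have ht : t ∈ LinearMap.range ι := by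
    by_contra hne
    have hne' : (LinearMap.range ι).mkQ t ≠ 0 := fun h => hne ((Submodule.Quotient.mk_eq_zero _).1 h)
    obtain ⟨c, hc⟩ := exists_hom_apply_ne_zero (k := k) hBA hgen hC hne'
    -- On Tⁿ the map c is v ↦ ∑ sⱼ vⱼ. It kills the image of ι, so ∑ sⱼ ιⱼ = 0 in Hom_R(X, T), and
    -- applying α gives ∑ sⱼ tⱼ = 0.
    choose s hs using fun j => hS.2 (c ∘ₗ (LinearMap.range ι).mkQ ∘ₗ LinearMap.single Rᵐᵒᵖ (fun _ : Fin n => T) j)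
    have hcs : ∀ v, c ((LinearMap.range ι).mkQ v) = ∑ j, s j • v j := fun v => by
      conv_lhs => rw [← LinearMap.sum_single_apply _ v, map_sum, map_sum]
      exact Finset.sum_congr rfl fun j _ => (LinearMap.congr_fun (hs j) (v j)).symm
    refine hc ?_
    rw [hcs, ← hα 0 s fun x => ?_, map_zero]
    have h0 : (LinearMap.range ι).mkQ (ι x) = 0 :=
      (Submodule.Quotient.mk_eq_zero (LinearMap.range ι)).2 ⟨x, rfl⟩
    rw [← hcs, h0, map_zero, LinearMap.zero_apply]
  obtain ⟨x, hx⟩ := ht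
  refine ⟨x, fun f => ?_⟩
  obtain ⟨s, hs⟩ := hgenι f
  rw [hα f s hs, hs, hx]

end Members


/-! ### Modules left orthogonal to K lie in Hom_R(T, A) -/

section LeftOrthogonal

attribute [local instance] smulCommClass_op

variable {k S R T : Type u} [CommRing k] [IsArtinianRing k] [Ring S] [Algebra k S] [Ring R]
  [Algebra k R] [AddCommGroup T] [Module k T] [Module S T] [Module Rᵐᵒᵖ T] [IsScalarTower k S T]
  [IsScalarTower k Rᵐᵒᵖ T] [SMulCommClass S Rᵐᵒᵖ T]
  {B A : ObjectProperty (ModuleCat.{u} Rᵐᵒᵖ)}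
  {G : Type u} [AddCommGroup G] [Module Sᵐᵒᵖ G]
  {X : Type u} [AddCommGroup X] [Module Rᵐᵒᵖ X]

/-- The homomorphism from a free module that is `m` times the `j`-th coordinate. -/
def coordSMul (R : Type u) {M : Type u} [Ring R] [AddCommGroup M] [Module Rᵐᵒᵖ M] {n : ℕ}
    (j : Fin n) (m : M) : (Fin n → Rᵐᵒᵖ) →ₗ[Rᵐᵒᵖ] M :=
  LinearMap.toSpanSingleton Rᵐᵒᵖ M m ∘ₗ LinearMap.proj j

@[simp] theorem coordSMul_apply {M : Type u} [AddCommGroup M] [Module Rᵐᵒᵖ M] {n : ℕ}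
    (j : Fin n) (m : M) (x : Fin n → Rᵐᵒᵖ) : coordSMul R j m x = x j • m := rfl

theorem eq_sum_coordSMul {M : Type u} [AddCommGroup M] [Module Rᵐᵒᵖ M] {n : ℕ}
    (f : (Fin n → Rᵐᵒᵖ) →ₗ[Rᵐᵒᵖ] M) : f = ∑ j, coordSMul R j (f (Pi.single j 1)) := by
  refine LinearMap.ext fun x => ?_
  rw [LinearMap.sum_apply]
  conv_lhs => rw [← LinearMap.sum_single_apply _ x, map_sum]
  refine Finset.sum_congr rfl fun j _ => ?_
  rw [coordSMul_apply, ← map_smul, ← Pi.single_smul, smul_eq_mul, mul_one]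

variable (k T) in
/-- The pairing of `G` and `Hom_R(X, T)` given by a functional on `Hom_R(X, G ⊗_S T)`. -/
noncomputable def tensorPairing (ξ : Dual k (X →ₗ[Rᵐᵒᵖ] BalancedTensor S R T G)) :
    G →ₗ[Sᵐᵒᵖ] Dual k (X →ₗ[Rᵐᵒᵖ] T) :=
  compPairing S T ξ ∘ₗ BalancedTensor.unit S R T G

omit [IsArtinianRing k] in
@[simp] theorem tensorPairing_apply (ξ : Dual k (X →ₗ[Rᵐᵒᵖ] BalancedTensor S R T G)) (g : G)
    (f : X →ₗ[Rᵐᵒᵖ] T) :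
    tensorPairing k T ξ g f = ξ ((BalancedTensor.unit S R T G g).hom ∘ₗ f) := rfl

omit [IsArtinianRing k] in
-- For X = Rⁿ the pairing is n copies of D(G ⊗_S T) ≅ Hom_S(G, DT).
theorem tensorPairing_surjective_of_free (n : ℕ) :
    Function.Surjective (tensorPairing (S := S) (R := R) (G := G) (X := Fin n → Rᵐᵒᵖ) k T) := by
  intro β
  let c (j : Fin n) : T →ₗ[S] ((Fin n → Rᵐᵒᵖ) →ₗ[Rᵐᵒᵖ] T) :=
    { toFun := fun t => coordSMul R j t
      map_add' := fun t t' => LinearMap.ext fun x => smul_add _ _ _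
      map_smul' := fun s t => LinearMap.ext fun x => smul_comm _ _ _ }
  choose ξ hξ using fun j => BalancedTensor.exists_dual (R := R) (Dual.rightMap k (c j) ∘ₗ β)
  let ev (j : Fin n) : ((Fin n → Rᵐᵒᵖ) →ₗ[Rᵐᵒᵖ] BalancedTensor S R T G) →ₗ[k]
    BalancedTensor S R T G := LinearMap.applyₗ' k (Pi.single j 1 : Fin n → Rᵐᵒᵖ)
  refine ⟨∑ j, Dual.map (ev j) (ξ j), LinearMap.ext fun g => Dual.ext fun f => ?_⟩
  rw [tensorPairing_apply, Dual.sum_apply]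
  conv_rhs => rw [eq_sum_coordSMul f, map_sum]
  exact Finset.sum_congr rfl fun j _ => hξ j g _

omit [IsArtinianRing k] in
theorem tensorPairing_injective_of_free (n : ℕ)
    {ξ : Dual k ((Fin n → Rᵐᵒᵖ) →ₗ[Rᵐᵒᵖ] BalancedTensor S R T G)}
    (hξ : tensorPairing k T ξ = 0) : ξ = 0 := by
  refine Dual.ext fun h => ?_
  rw [eq_sum_coordSMul h, map_sum, Dual.zero_apply]
  refine Finset.sum_eq_zero fun j _ => ?_
  refine BalancedTensor.induction (p := fun m => ξ (coordSMul R j m) = 0) ?_ (fun t g => ?_)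
    (fun x y hx hy => ?_) _
  · rw [← map_zero ξ]
    exact congrArg ξ (LinearMap.ext fun x => smul_zero (x j))
  · exact DFunLike.congr_fun (LinearMap.congr_fun hξ g) (coordSMul R j t)
  · have h1 : coordSMul R j (x + y) = coordSMul R j x + coordSMul R j y :=
      LinearMap.ext fun z => smul_add (z j) x y
    rw [h1, map_add, hx, hy, add_zero]

variable [IsNoetherianRing Rᵐᵒᵖ] (hBA : IsHereditaryCotorsionPair B A)
  (hTA : A (ModuleCat.of Rᵐᵒᵖ T))
  (hG : ∀ (X : Type u) [AddCommGroup X] [Module Rᵐᵒᵖ X], B (ModuleCat.of Rᵐᵒᵖ X) →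
    ExtVanishes Sᵐᵒᵖ G (Dual k (X →ₗ[Rᵐᵒᵖ] T)))

omit [IsArtinianRing k] [IsNoetherianRing Rᵐᵒᵖ] [Algebra k R] [IsScalarTower k Rᵐᵒᵖ T] [Module k T]
  [Algebra k S] [IsScalarTower k S T] [CommRing k] in
theorem lcomp_exact {Y Z : Type u} [AddCommGroup Y] [Module Rᵐᵒᵖ Y] [AddCommGroup Z]
    [Module Rᵐᵒᵖ Z] {f : X →ₗ[Rᵐᵒᵖ] Y} {p : Y →ₗ[Rᵐᵒᵖ] Z} (hfp : Function.Exact f p)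
    (hp : Function.Surjective p) :
    Function.Exact (LinearMap.lcomp S T p) (LinearMap.lcomp S T f) := by
  intro h
  constructor
  · intro hh
    obtain ⟨h', hh'⟩ := exists_factor_of_surjective hp h fun x hx => by
      obtain ⟨y, rfl⟩ := (hfp x).1 hx
      exact LinearMap.congr_fun hh y
    exact ⟨h', LinearMap.ext hh'⟩
  · rintro ⟨h', rfl⟩
    refine LinearMap.ext fun x => ?_
    change h' (p (f x)) = 0
    rw [hfp.apply_apply_eq_zero, map_zero]

include hBA hTA hG

omit [IsArtinianRing k] in
-- Ext¹(X, T) = 0 makes 0 → D Hom(N, T) → D Hom(F, T) → D Hom(X, T) → 0 exact, and Ext¹(G, D Hom(N,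
-- T)) = 0 lifts β to the free case.
theorem tensorPairing_surjective (hX : B (ModuleCat.of Rᵐᵒᵖ X)) :
    Function.Surjective (tensorPairing (S := S) (R := R) (G := G) (X := X) k T) := by
  intro β
  obtain ⟨n, p, hp, hN⟩ := hBA.exists_presentation hX
  have hex := LinearMap.exact_subtype_ker_map p
  have hsurj : Function.Surjective (LinearMap.lcomp S T (LinearMap.ker p).subtype) := fun φ => by
    obtain ⟨ψ, hψ⟩ := (hBA.isCotorsionPair.extVanishes hX hTA).exists_extension
      (LinearMap.ker p).injective_subtype hex hp φ
    exact ⟨ψ, LinearMap.ext hψ⟩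
  have hinj : Function.Injective (LinearMap.lcomp S T p) := fun φ ψ h => LinearMap.ext fun x => by
    obtain ⟨y, rfl⟩ := hp x
    exact LinearMap.congr_fun h y
  obtain ⟨β', hβ'⟩ := (hG _ hN).exists_lift
    (f := Dual.rightMap k (LinearMap.lcomp S T (LinearMap.ker p).subtype))
    (g := Dual.rightMap k (LinearMap.lcomp S T p))
    (Dual.map_injective (f := (LinearMap.lcomp S T (LinearMap.ker p).subtype).restrictScalars k)
      hsurj)
    (Dual.exact_map (f := (LinearMap.lcomp S T p).restrictScalars k)
      (g := (LinearMap.lcomp S T (LinearMap.ker p).subtype).restrictScalars k)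
      (lcomp_exact hex hp))
    (Dual.map_surjective (f := (LinearMap.lcomp S T p).restrictScalars k) hinj) β
  obtain ⟨ξ, rfl⟩ := tensorPairing_surjective_of_free n β'
  refine ⟨Dual.map (LinearMap.lcomp k _ p) ξ, LinearMap.ext fun g => ?_⟩
  rw [← hβ']
  rfl

/-- Extend ξ to ξ' on Hom(F, G ⊗ T). Its pairing comes from D Hom(N, T), hence by surjectivity for N
from a functional ξ''. By the free case ξ' is induced by ξ'', and this vanishes on maps factoring
through F → X. -/
theorem tensorPairing_injective (hX : B (ModuleCat.of Rᵐᵒᵖ X))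
    {ξ : Dual k (X →ₗ[Rᵐᵒᵖ] BalancedTensor S R T G)} (hξ : tensorPairing k T ξ = 0) : ξ = 0 := by
  obtain ⟨n, p, hp, hN⟩ := hBA.exists_presentation hX
  have hex := LinearMap.exact_subtype_ker_map p
  have hinj : Function.Injective (LinearMap.lcomp k (BalancedTensor S R T G) p) :=
    fun φ ψ h => LinearMap.ext fun x => by
      obtain ⟨y, rfl⟩ := hp x
      exact LinearMap.congr_fun h y
  obtain ⟨ξ', rfl⟩ := Dual.map_surjective hinj ξ
  have hsurj : Function.Surjective (LinearMap.lcomp S T (LinearMap.ker p).subtype) := fun φ => by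
    obtain ⟨ψ, hψ⟩ := (hBA.isCotorsionPair.extVanishes hX hTA).exists_extension
      (LinearMap.ker p).injective_subtype hex hp φ
    exact ⟨ψ, LinearMap.ext hψ⟩
  obtain ⟨β, hβ⟩ := exists_comp_eq_of_exact
    (φ := Dual.rightMap k (LinearMap.lcomp S T (LinearMap.ker p).subtype))
    (ψ := Dual.rightMap k (LinearMap.lcomp S T p))
    (Dual.map_injective (f := (LinearMap.lcomp S T (LinearMap.ker p).subtype).restrictScalars k)
      hsurj)
    (Dual.exact_map (f := (LinearMap.lcomp S T p).restrictScalars k)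
      (g := (LinearMap.lcomp S T (LinearMap.ker p).subtype).restrictScalars k)
      (lcomp_exact hex hp)) (tensorPairing k T ξ') hξ
  obtain ⟨ξ'', rfl⟩ := tensorPairing_surjective hBA hTA hG hN β
  have h1 : ξ' - Dual.map (LinearMap.lcomp k _ (LinearMap.ker p).subtype) ξ'' = 0 := by
    refine tensorPairing_injective_of_free n (LinearMap.ext fun g => Dual.ext fun f => ?_)
    have h2 := DFunLike.congr_fun (LinearMap.congr_fun hβ g) f
    exact sub_eq_zero.2 h2.symm
  rw [sub_eq_zero.1 h1]
  refine Dual.ext fun h => ?_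
  have h3 : (h ∘ₗ p) ∘ₗ (LinearMap.ker p).subtype = 0 := LinearMap.ext fun x => by
    change h (p x) = 0
    rw [LinearMap.mem_ker.1 x.2, map_zero]
  exact (congrArg ξ'' h3).trans (map_zero ξ'')

/-- Restriction Hom(F, G ⊗ T) → Hom(N, G ⊗ T) is onto: a functional killing its image has zero
pairing, as every N → T extends to F, so it is zero by injectivity for N. -/
theorem extVanishes_tensor (hX : B (ModuleCat.of Rᵐᵒᵖ X)) :
    ExtVanishes Rᵐᵒᵖ X (BalancedTensor S R T G) := by
  obtain ⟨n, p, hp, hN⟩ := hBA.exists_presentation hX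
  have hex := LinearMap.exact_subtype_ker_map p
  have hsurj : Function.Surjective
      (LinearMap.lcomp k (BalancedTensor S R T G) (LinearMap.ker p).subtype) := by
    refine Dual.surjective_of_forall fun ξ hξ => tensorPairing_injective hBA hTA hG hN
      (LinearMap.ext fun g => Dual.ext fun f => ?_)
    obtain ⟨f', hf'⟩ := (hBA.isCotorsionPair.extVanishes hX hTA).exists_extension
      (LinearMap.ker p).injective_subtype hex hp f
    have h1 : f = f' ∘ₗ (LinearMap.ker p).subtype := LinearMap.ext fun x => (hf' x).symm
    rw [h1]
    exact hξ ((BalancedTensor.unit S R T G g).hom ∘ₗ f')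
  refine ExtVanishes.of_extension (LinearMap.ker p).injective_subtype hex hp
    extVanishes_of_projective fun φ => ?_
  obtain ⟨ψ, hψ⟩ := hsurj φ
  exact ⟨ψ, LinearMap.congr_fun hψ⟩

/-- The pairing at X = T, where End(T_R) = S identifies Hom_S(G, D End(T_R)) with DG. -/
theorem unit_bijective_of_extVanishes [Module k G] [IsScalarTower k Sᵐᵒᵖ G]
    (hS : Function.Bijective (Module.toModuleEnd Rᵐᵒᵖ T : S →+* Module.End Rᵐᵒᵖ T))
    (hTB : B (ModuleCat.of Rᵐᵒᵖ T)) : Function.Bijective (BalancedTensor.unit S R T G) := by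
  constructor
  · refine (injective_iff_map_eq_zero _).2 fun g hg => Dual.eq_zero_of_forall (k := k) fun φ => ?_
    let e := RingEquiv.ofBijective _ hS
    have he : ∀ (f : Module.End Rᵐᵒᵖ T) (t : T), e.symm f • t = f t := fun f t =>
      LinearMap.congr_fun (e.apply_symm_apply f) t
    have hsmul : ∀ (c : k) (g : G), c • g = op (algebraMap k S c) • g := fun c g => by
      rw [← smul_one_smul Sᵐᵒᵖ c g, Algebra.algebraMap_eq_smul_one, op_smul, op_one]
    let β : G →ₗ[Sᵐᵒᵖ] Dual k (T →ₗ[Rᵐᵒᵖ] T) :=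
      { toFun := fun g => Dual.of
          { toFun := fun f => φ (op (e.symm f) • g)
            map_add' := fun f f' => by
              rw [map_add e.symm, MulOpposite.op_add, add_smul, map_add]
            map_smul' := fun c f => by
              have h1 : e.symm (c • f) = c • e.symm f := (e.symm_apply_eq).2
                (LinearMap.ext fun t => by
                  change c • f t = (c • e.symm f) • t
                  rw [smul_assoc, he])
              rw [h1, op_smul, smul_assoc, map_smul, RingHom.id_apply] }
        map_add' := fun g g' => Dual.ext fun f =>
          (congrArg φ (smul_add _ g g')).trans (map_add φ _ _)
        map_smul' := fun s g => Dual.ext fun f => by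
          change φ (op (e.symm f) • s • g) = φ (op (e.symm (unop s • f)) • g)
          have h1 : e.symm (unop s • f) = unop s * e.symm f := (e.symm_apply_eq).2
            (LinearMap.ext fun t => by
              change unop s • f t = (unop s * e.symm f) • t
              rw [mul_smul, he])
          rw [h1, smul_smul]
          rfl }
    obtain ⟨ξ, hξ⟩ := tensorPairing_surjective hBA hTA hG hTB β
    have h1 := DFunLike.congr_fun (LinearMap.congr_fun hξ g) (LinearMap.id : T →ₗ[Rᵐᵒᵖ] T)
    rw [tensorPairing_apply, hg] at h1
    have h2 : e.symm (LinearMap.id : T →ₗ[Rᵐᵒᵖ] T) = 1 := map_one e.symm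
    have h3 : β g (LinearMap.id : T →ₗ[Rᵐᵒᵖ] T) = φ g := by
      change φ (op (e.symm (LinearMap.id : T →ₗ[Rᵐᵒᵖ] T)) • g) = φ g
      rw [h2, op_one, one_smul]
    rw [← h3, ← h1]
    exact map_zero ξ
  · refine Dual.surjective_of_forall (f := (BalancedTensor.unit S R T G).restrictScalars k)
      fun ξ hξ => tensorPairing_injective hBA hTA hG hTB
        (LinearMap.ext fun g => Dual.ext fun f => ?_)
    obtain ⟨s, rfl⟩ := hS.2 f
    have h1 := hξ (op s • g)
    rw [LinearMap.restrictScalars_apply, map_smul] at h1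
    exact h1

end LeftOrthogonal


/-! ### Modules right orthogonal to G lie in B ⊗_R DT -/

section RightOrthogonal

attribute [local instance] smulCommClass_op

variable {k S R T : Type u} [CommRing k] [IsArtinianRing k] [Ring S] [Algebra k S] [Ring R]
  [Algebra k R] [AddCommGroup T] [Module k T] [Module S T] [Module Rᵐᵒᵖ T] [IsScalarTower k S T]
  [IsScalarTower k Rᵐᵒᵖ T] [SMulCommClass S Rᵐᵒᵖ T]
  {B A : ObjectProperty (ModuleCat.{u} Rᵐᵒᵖ)}
  {L : Type u} [AddCommGroup L] [Module S L] [Module k L] [IsScalarTower k S L]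
  {Y : Type u} [AddCommGroup Y] [Module Rᵐᵒᵖ Y] [Module k Y] [IsScalarTower k Rᵐᵒᵖ Y]

variable (S R T L) in
/-- The evaluation `L → Hom_R(Hom_S(L, T), T)`. -/
def leftEval : L →ₗ[S] ((L →ₗ[S] T) →ₗ[Rᵐᵒᵖ] T) where
  toFun l :=
    { toFun := fun b => b l
      map_add' := fun _ _ => rfl
      map_smul' := fun _ _ => rfl }
  map_add' l l' := LinearMap.ext fun b => map_add b l l'
  map_smul' s l := LinearMap.ext fun b => map_smul b s l

variable (T L) in
/-- The pairing of `Hom_R(T, Y)` and `L` given by a functional on `Hom_R(Hom_S(L, T), Y)`. -/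
noncomputable def evalPairing (ξ : Dual k ((L →ₗ[S] T) →ₗ[Rᵐᵒᵖ] Y)) :
    RightHom R T Y →ₗ[Sᵐᵒᵖ] Dual k L :=
  Dual.rightMap k (leftEval S R T L) ∘ₗ compPairing S T ξ

omit [IsArtinianRing k] in
@[simp] theorem evalPairing_apply (ξ : Dual k ((L →ₗ[S] T) →ₗ[Rᵐᵒᵖ] Y)) (g : RightHom R T Y)
    (l : L) : evalPairing T L ξ g l = ξ (g.hom ∘ₗ leftEval S R T L l) := rfl

variable (k S R T) in
/-- The isomorphism `D T → Hom_R(T, D R)`, as a map of right `S`-modules. -/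
noncomputable def coindHom : Dual k T →ₗ[Sᵐᵒᵖ] RightHom R T (Dual k R) where
  toFun φ := RightHom.of (Dual.coind R φ)
  map_add' _ _ := rfl
  map_smul' s φ := RightHom.ext fun t => Dual.ext fun r => by
    change φ (unop s • op r • t) = φ (op r • unop s • t)
    rw [smul_comm]

theorem evalPairing_surjective_of_pi_dual [Module.Finite k T] (n : ℕ) :
    Function.Surjective (evalPairing (k := k) (S := S) (R := R) (Y := Fin n → Dual k R) T L) := by
  intro β
  -- On the j-th copy of Hom_R(T, DR) ≅ DT, β is a map DT → DL, dual to some αⱼ : L → T; the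
  -- functional sought evaluates at these αⱼ.
  choose α hα using fun j : Fin n => exists_hom_of_dual
    (β ∘ₗ RightHom.map S T (LinearMap.single Rᵐᵒᵖ (fun _ => Dual k R) j) ∘ₗ coindHom k S R T)
  refine ⟨∑ j, Dual.of
    { toFun := fun h => h (α j) j 1
      map_add' := fun _ _ => rfl
      map_smul' := fun _ _ => rfl }, LinearMap.ext fun g => Dual.ext fun l => ?_⟩
  have hg : g = ∑ j, RightHom.of (LinearMap.single Rᵐᵒᵖ (fun _ => Dual k R) j ∘ₗ
      Dual.coind R (Dual.evalOne (LinearMap.proj j ∘ₗ g.hom))) := by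
    rw [← RightHom.of_sum]
    refine RightHom.ext fun t => ?_
    conv_lhs => rw [← LinearMap.sum_single_apply _ (g.hom t)]
    rw [RightHom.hom_of, LinearMap.sum_apply]
    refine Finset.sum_congr rfl fun j _ => ?_
    rw [Dual.coind_evalOne]
    rfl
  rw [evalPairing_apply, Dual.sum_apply]
  conv_rhs => rw [hg, map_sum, Dual.sum_apply]
  exact Finset.sum_congr rfl fun j _ =>
    (hα j l (Dual.evalOne
      ((LinearMap.proj j : (Fin n → Dual k R) →ₗ[Rᵐᵒᵖ] Dual k R) ∘ₗ g.hom))).symm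

theorem evalPairing_injective_of_pi_dual [Module.Finite k T] [Module.Finite k (L →ₗ[S] T)] (n : ℕ)
    {ξ : Dual k ((L →ₗ[S] T) →ₗ[Rᵐᵒᵖ] (Fin n → Dual k R))} (hξ : evalPairing T L ξ = 0) :
    ξ = 0 := by
  let c (j : Fin n) : Dual k (L →ₗ[S] T) →ₗ[k] ((L →ₗ[S] T) →ₗ[Rᵐᵒᵖ] (Fin n → Dual k R)) :=
    { toFun := fun ψ => LinearMap.single Rᵐᵒᵖ (fun _ => Dual k R) j ∘ₗ Dual.coind R ψ
      map_add' := fun ψ ψ' => by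
        rw [← LinearMap.comp_add]
        rfl
      map_smul' := fun a ψ => by
        rw [RingHom.id_apply]
        refine LinearMap.ext fun b => ?_
        change (Pi.single j (a • Dual.coind R ψ b) : Fin n → Dual k R) =
          a • Pi.single j (Dual.coind R ψ b)
        rw [Pi.single_smul] }
  have hc : ∀ j ψ, ξ (c j ψ) = 0 := by
    intro j ψ
    -- Hom_R(Hom_S(L, T), DR) is D Hom_S(L, T), so ξ restricted to the j-th copy is evaluation at
    -- some b : L → T. The hypothesis on ξ says φ(b l) = 0 for all φ and l.
    obtain ⟨b, hb⟩ := (Dual.eval_bijective (k := k) (L →ₗ[S] T)).2 (Dual.map (c j) ξ)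
    have hb' : ∀ ψ, ξ (c j ψ) = ψ b := fun ψ => (DFunLike.congr_fun hb ψ).symm
    have hb0 : b = 0 := by
      refine LinearMap.ext fun l => Dual.eq_zero_of_forall (k := k) fun φ => ?_
      have h1 := DFunLike.congr_fun (LinearMap.congr_fun hξ (RightHom.of
        (LinearMap.single Rᵐᵒᵖ (fun _ => Dual k R) j ∘ₗ Dual.coind R φ))) l
      refine Eq.trans ?_ h1
      exact (hb' (Dual.map ((leftEval S R T L l).restrictScalars k) φ)).symm
    rw [hb', hb0, map_zero]
  refine Dual.ext fun h => ?_
  have hh : h = ∑ j, c j (Dual.evalOne (LinearMap.proj j ∘ₗ h)) := by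
    refine LinearMap.ext fun b => ?_
    conv_lhs => rw [← LinearMap.sum_single_apply _ (h b)]
    rw [LinearMap.sum_apply]
    refine Finset.sum_congr rfl fun j _ => ?_
    change _ = (Pi.single j (Dual.coind R (Dual.evalOne (LinearMap.proj j ∘ₗ h)) b) : Fin n → Dual k R)
    rw [Dual.coind_evalOne]
    rfl
  rw [hh, map_sum, Dual.zero_apply]
  exact Finset.sum_eq_zero fun j _ => hc j _

/-- A finitely generated module embeds into a finite power of `D R`. -/
theorem exists_injective_pi_dual (k R Y : Type u) [CommRing k] [IsArtinianRing k] [Ring R]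
    [Algebra k R] [AddCommGroup Y] [Module Rᵐᵒᵖ Y] [Module k Y] [IsScalarTower k Rᵐᵒᵖ Y]
    [Module.Finite k Y] :
    ∃ (n : ℕ) (ι : Y →ₗ[Rᵐᵒᵖ] (Fin n → Dual k R)), Function.Injective ι := by
  obtain ⟨n, φ, hφ⟩ := Module.Finite.exists_fin (R := k) (M := Dual k Y)
  refine ⟨n, LinearMap.pi fun j => Dual.coind R (φ j), (injective_iff_map_eq_zero _).2 fun y hy =>
    Dual.eq_zero_of_forall (k := k) fun ψ => ?_⟩
  have h1 : ∀ j, φ j y = 0 := fun j => by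
    have h2 := DFunLike.congr_fun (congrFun hy j) (1 : R)
    rw [LinearMap.pi_apply, Dual.coind_apply, op_one, one_smul] at h2
    exact h2
  have h2 : ψ ∈ Submodule.span k (Set.range φ) := hφ ▸ Submodule.mem_top
  obtain ⟨c, rfl⟩ := (Submodule.mem_span_range_iff_exists_fun k).1 h2
  rw [Dual.sum_apply]
  exact Finset.sum_eq_zero fun j _ => by rw [Dual.smul_apply, h1, smul_zero]

variable [Module.Finite k R] (hBA : IsHereditaryCotorsionPair B A)

include hBA in
theorem IsHereditaryCotorsionPair.exists_injective_copresentation (hY : A (ModuleCat.of Rᵐᵒᵖ Y)) :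
    ∃ (n : ℕ) (ι : Y →ₗ[Rᵐᵒᵖ] (Fin n → Dual k R)), Function.Injective ι ∧
      A (ModuleCat.of Rᵐᵒᵖ ((Fin n → Dual k R) ⧸ LinearMap.range ι)) := by
  have : IsNoetherianRing Rᵐᵒᵖ := isNoetherianRing_mulOpposite k R
  have : Module.Finite Rᵐᵒᵖ Y := ((hBA.isCotorsionPair.right_iff _).1 hY).1
  have : Module.Finite k Y := Module.Finite.trans Rᵐᵒᵖ Y
  obtain ⟨n, ι, hι⟩ := exists_injective_pi_dual k R Y
  exact ⟨n, ι, hι, hBA.mem_of_exact hι (LinearMap.exact_map_mkQ_range ι)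
    (Submodule.mkQ_surjective _) hY (hBA.pi_dual_mem n)⟩

variable [Module.Finite k T] [Module.Finite k L]
  (hT : ∀ (Y : Type u) [AddCommGroup Y] [Module Rᵐᵒᵖ Y], A (ModuleCat.of Rᵐᵒᵖ Y) →
    ExtVanishes Rᵐᵒᵖ T Y)
  (hL : ∀ (Y : Type u) [AddCommGroup Y] [Module Rᵐᵒᵖ Y], A (ModuleCat.of Rᵐᵒᵖ Y) →
    ExtVanishes Sᵐᵒᵖ (RightHom R T Y) (Dual k L))

omit [IsArtinianRing k] [Algebra k R] [Module.Finite k R] [IsScalarTower k Rᵐᵒᵖ T]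
  [IsScalarTower k Rᵐᵒᵖ Y] [Module k T] [Algebra k S] [IsScalarTower k S T] [CommRing k]
  [Module k Y] [Module.Finite k T] in
theorem RightHom.map_surjective {I Z : Type u} [AddCommGroup I] [Module Rᵐᵒᵖ I] [AddCommGroup Z]
    [Module Rᵐᵒᵖ Z] {ι : Y →ₗ[Rᵐᵒᵖ] I} {q : I →ₗ[Rᵐᵒᵖ] Z} (hι : Function.Injective ι)
    (hex : Function.Exact ι q) (hq : Function.Surjective q) (h : ExtVanishes Rᵐᵒᵖ T Y) :
    Function.Surjective (RightHom.map S T q) := fun g => by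
  obtain ⟨g', hg'⟩ := h.exists_lift hι hex hq g.hom
  exact ⟨RightHom.of g', RightHom.ext hg'⟩

include hBA hT hL

omit [Module.Finite k L] in
-- Ext¹(Hom_R(T, Z), DL) = 0 extends β from Hom_R(T, Y) to Hom_R(T, (DR)ⁿ), where the pairing is
-- already onto; this uses that the cokernel Z is in A.
theorem evalPairing_surjective (hY : A (ModuleCat.of Rᵐᵒᵖ Y)) :
    Function.Surjective (evalPairing (k := k) (S := S) (R := R) (Y := Y) T L) := by
  intro β
  obtain ⟨n, ι, hι, hZ⟩ := hBA.exists_injective_copresentation (k := k) hY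
  have hex := LinearMap.exact_map_mkQ_range ι
  have hq := Submodule.mkQ_surjective (LinearMap.range ι)
  obtain ⟨β', hβ'⟩ := (hL _ hZ).exists_extension (RightHom.map_injective (S := S) (V := T) hι)
    (RightHom.map_exact hι hex) (RightHom.map_surjective hι hex hq (hT _ hY)) β
  obtain ⟨ξ, rfl⟩ := evalPairing_surjective_of_pi_dual n β'
  refine ⟨Dual.map (LinearMap.compRight k ι) ξ, LinearMap.ext fun g => ?_⟩
  rw [← hβ']
  rfl

/-- Lift ξ to maps into (DR)ⁿ. The pairing of the lift factors through Hom_R(T, Z), hence comes from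
a functional on maps into Z, which vanishes on maps that come from Y. -/
theorem evalPairing_injective (hY : A (ModuleCat.of Rᵐᵒᵖ Y))
    {ξ : Dual k ((L →ₗ[S] T) →ₗ[Rᵐᵒᵖ] Y)} (hξ : evalPairing T L ξ = 0) : ξ = 0 := by
  have : Module.Finite k (L →ₗ[S] T) :=
    Module.Finite.of_injective (LinearMap.restrictScalarsₗ k S L T k)
      (LinearMap.restrictScalars_injective k)
  obtain ⟨n, ι, hι, hZ⟩ := hBA.exists_injective_copresentation (k := k) hY
  have hex := LinearMap.exact_map_mkQ_range ι
  have hq := Submodule.mkQ_surjective (LinearMap.range ι)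
  obtain ⟨ξ', rfl⟩ := Dual.map_surjective (f := LinearMap.compRight k (M := L →ₗ[S] T) ι)
    (fun f g h => LinearMap.ext fun x => hι (LinearMap.congr_fun h x)) ξ
  obtain ⟨β, hβ⟩ := exists_factor_of_surjective
    (RightHom.map_surjective (S := S) hι hex hq (hT _ hY)) (evalPairing T L ξ') fun g hg => by
      obtain ⟨g', rfl⟩ := (RightHom.map_exact hι hex g).1 hg
      exact LinearMap.congr_fun hξ g'
  obtain ⟨ξ'', rfl⟩ := evalPairing_surjective hBA hT hL hZ β
  have h1 : ξ' - Dual.map (LinearMap.compRight k (LinearMap.range ι).mkQ) ξ'' = 0 := by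
    refine evalPairing_injective_of_pi_dual n (LinearMap.ext fun g => Dual.ext fun l => ?_)
    have h2 := DFunLike.congr_fun (hβ g) l
    exact sub_eq_zero.2 h2.symm
  rw [sub_eq_zero.1 h1]
  refine Dual.ext fun h => ?_
  have h3 : (LinearMap.range ι).mkQ ∘ₗ ι ∘ₗ h = 0 :=
    LinearMap.ext fun x => hex.apply_apply_eq_zero _
  exact (congrArg ξ'' h3).trans (map_zero ξ'')

/-- Maps Hom_S(L, T) → Z lift to the injective (DR)ⁿ: a functional vanishing on the liftable ones
has zero pairing, since every T → Z lifts. -/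
theorem extVanishes_leftHom (hY : A (ModuleCat.of Rᵐᵒᵖ Y)) :
    ExtVanishes Rᵐᵒᵖ (L →ₗ[S] T) Y := by
  obtain ⟨n, ι, hι, hZ⟩ := hBA.exists_injective_copresentation (k := k) hY
  have hex := LinearMap.exact_map_mkQ_range ι
  have hq := Submodule.mkQ_surjective (LinearMap.range ι)
  have hsurj : Function.Surjective
      (LinearMap.compRight k (M := L →ₗ[S] T) (LinearMap.range ι).mkQ) := by
    refine Dual.surjective_of_forall fun ξ hξ => evalPairing_injective hBA hT hL hZ
      (LinearMap.ext fun g => Dual.ext fun l => ?_)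
    obtain ⟨g', rfl⟩ := RightHom.map_surjective (S := S) hι hex hq (hT _ hY) g
    exact hξ (g'.hom ∘ₗ leftEval S R T L l)
  refine ExtVanishes.of_lift hι hex hq extVanishes_of_injective fun φ => ?_
  obtain ⟨ψ, hψ⟩ := hsurj φ
  exact ⟨ψ, LinearMap.congr_fun hψ⟩

/-- The pairing at Y = T, where End(T_R) = S identifies Hom_S(End(T_R), DL) with DL. -/
theorem leftEval_bijective
    (hS : Function.Bijective (Module.toModuleEnd Rᵐᵒᵖ T : S →+* Module.End Rᵐᵒᵖ T))
    (hTA : A (ModuleCat.of Rᵐᵒᵖ T)) : Function.Bijective (leftEval S R T L) := by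
  let e := RingEquiv.ofBijective _ hS
  have he : ∀ (f : Module.End Rᵐᵒᵖ T) (t : T), e.symm f • t = f t := fun f t =>
    LinearMap.congr_fun (e.apply_symm_apply f) t
  constructor
  · refine (injective_iff_map_eq_zero _).2 fun l hl => Dual.eq_zero_of_forall (k := k) fun φ => ?_
    let β : RightHom R T T →ₗ[Sᵐᵒᵖ] Dual k L :=
      { toFun := fun g => op (e.symm g.hom) • φ
        map_add' := fun g g' => by
          rw [RightHom.hom_add, map_add e.symm, MulOpposite.op_add, add_smul]
        map_smul' := fun s g => by
          have h1 : e.symm (s • g).hom = e.symm g.hom * unop s := (e.symm_apply_eq).2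
            (LinearMap.ext fun t => by
              change g.hom (unop s • t) = (e.symm g.hom * unop s) • t
              rw [mul_smul, he])
          rw [h1, op_mul, mul_smul, op_unop, RingHom.id_apply] }
    obtain ⟨ξ, hξ⟩ := evalPairing_surjective hBA hT hL hTA β
    have h1 := DFunLike.congr_fun (LinearMap.congr_fun hξ (RightHom.of LinearMap.id)) l
    rw [evalPairing_apply, hl, LinearMap.comp_zero, map_zero] at h1
    have h2 : e.symm (LinearMap.id : T →ₗ[Rᵐᵒᵖ] T) = 1 := map_one e.symm
    have h3 : β (RightHom.of LinearMap.id) l = φ l := by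
      change φ (e.symm (LinearMap.id : T →ₗ[Rᵐᵒᵖ] T) • l) = φ l
      rw [h2, one_smul]
    rw [← h3, ← h1]
  · refine Dual.surjective_of_forall (f := (leftEval S R T L).restrictScalars k)
      fun ξ hξ => evalPairing_injective hBA hT hL hTA
        (LinearMap.ext fun g => Dual.ext fun l => ?_)
    have h1 := hξ (e.symm g.hom • l)
    rw [LinearMap.restrictScalars_apply, map_smul] at h1
    refine Eq.trans (congrArg ξ (LinearMap.ext fun b => ?_)) h1
    exact (he g.hom (b l)).symm

end RightOrthogonal


/-! ### The cotorsion pair (G, K) and the counter equivalence -/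

section Main

attribute [local instance] smulCommClass_op

variable {k S R T : Type u} [CommRing k] [IsArtinianRing k] [Ring S] [Algebra k S] [Ring R]
  [Algebra k R] [AddCommGroup T] [Module k T] [Module S T] [Module Rᵐᵒᵖ T] [IsScalarTower k S T]
  [IsScalarTower k Rᵐᵒᵖ T] [SMulCommClass S Rᵐᵒᵖ T]
  {B A : ObjectProperty (ModuleCat.{u} Rᵐᵒᵖ)}
  (hS : Function.Bijective (Module.toModuleEnd Rᵐᵒᵖ T : S →+* Module.End Rᵐᵒᵖ T))
  (hBA : IsHereditaryCotorsionPair B A) (hgen : IsExtProjectiveGenerator T A)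

omit [SMulCommClass S Rᵐᵒᵖ T] [IsScalarTower k Rᵐᵒᵖ T] in
-- A faithful action embeds S in End_k(T), which is finite over the noetherian ring k.
theorem finite_of_faithful [Module.Finite k T]
    (h : ∀ s : S, (∀ t : T, s • t = 0) → s = 0) : Module.Finite k S :=
  Module.Finite.of_injective (Algebra.lsmul k k T : S →ₐ[k] Module.End k T).toLinearMap
    ((injective_iff_map_eq_zero _).2 fun s hs => h s fun t => LinearMap.congr_fun hs t)

omit [IsArtinianRing k] in
include hBA in
theorem IsHereditaryCotorsionPair.finite_left [Module.Finite k R] {X : Type u} [AddCommGroup X]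
    [Module Rᵐᵒᵖ X] [Module k X] [IsScalarTower k Rᵐᵒᵖ X] (hX : B (ModuleCat.of Rᵐᵒᵖ X)) :
    Module.Finite k X :=
  have : Module.Finite Rᵐᵒᵖ X := ((hBA.isCotorsionPair.left_iff _).1 hX).1
  Module.Finite.trans Rᵐᵒᵖ X

omit [IsArtinianRing k] in
include hBA in
theorem IsHereditaryCotorsionPair.finite_right [Module.Finite k R] {X : Type u} [AddCommGroup X]
    [Module Rᵐᵒᵖ X] [Module k X] [IsScalarTower k Rᵐᵒᵖ X] (hX : A (ModuleCat.of Rᵐᵒᵖ X)) :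
    Module.Finite k X :=
  have : Module.Finite Rᵐᵒᵖ X := ((hBA.isCotorsionPair.right_iff _).1 hX).1
  Module.Finite.trans Rᵐᵒᵖ X

variable [Module.Finite k R] [Module.Finite k T]

include hBA

omit [IsScalarTower k S T] [Algebra k S] in
theorem mem_left_of_extProjective (hgen : IsExtProjectiveGenerator T A) :
    B (ModuleCat.of Rᵐᵒᵖ T) :=
  (hBA.isCotorsionPair.left_iff _).2 ⟨((hBA.isCotorsionPair.right_iff _).1 hgen.mem).1,
    hgen.extProjective⟩

include k in
theorem finite_of_map_homFunctor {G : ModuleCat.{u} Sᵐᵒᵖ} (hG : A.map (homFunctor S R T) G) :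
    Module.Finite Sᵐᵒᵖ G := by
  obtain ⟨Y, hY, ⟨e⟩⟩ := hG
  let := Module.restrictScalars k Rᵐᵒᵖ Y
  have := IsScalarTower.restrictScalars k Rᵐᵒᵖ Y
  have := hBA.finite_right (k := k) hY
  have : Module.Finite k (RightHom R T Y) :=
    Module.Finite.of_injective (LinearMap.restrictScalarsₗ k Rᵐᵒᵖ T Y k)
      (LinearMap.restrictScalars_injective k)
  have : Module.Finite Sᵐᵒᵖ (RightHom R T Y) := Module.Finite.of_restrictScalars_finite k _ _
  exact Module.Finite.equiv (show RightHom R T Y ≃ₗ[Sᵐᵒᵖ] G from e.toLinearEquiv)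

/-- Every object of `B ⊗_R D T` has the form `D Hom_R(X, T)`. -/
theorem exists_equiv_of_map_tensorFunctor {K : ModuleCat.{u} Sᵐᵒᵖ}
    (hK : B.map (tensorFunctor R S (Dual k T)) K) : ∃ (X : Type u) (_ : AddCommGroup X)
      (_ : Module Rᵐᵒᵖ X) (_ : Module k X) (_ : IsScalarTower k Rᵐᵒᵖ X),
      B (ModuleCat.of Rᵐᵒᵖ X) ∧ Nonempty (Dual k (X →ₗ[Rᵐᵒᵖ] T) ≃ₗ[Sᵐᵒᵖ] K) := by
  obtain ⟨X, hX, ⟨e⟩⟩ := hK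
  let := Module.restrictScalars k Rᵐᵒᵖ X
  have := IsScalarTower.restrictScalars k Rᵐᵒᵖ X
  have := hBA.finite_left (k := k) hX
  exact ⟨X, inferInstance, inferInstance, inferInstance, inferInstance, hX,
    ⟨(LinearEquiv.ofBijective _ (tensorDualMap_bijective (k := k) (S := S) (R := R) (T := T)
      (X := X))).symm.trans
      (show BalancedTensor R S (Dual k T) X ≃ₗ[Sᵐᵒᵖ] K from e.toLinearEquiv)⟩⟩

theorem finite_of_map_tensorFunctor {K : ModuleCat.{u} Sᵐᵒᵖ}
    (hK : B.map (tensorFunctor R S (Dual k T)) K) : Module.Finite Sᵐᵒᵖ K := by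
  obtain ⟨X, _, _, _, _, hX, ⟨e⟩⟩ := exists_equiv_of_map_tensorFunctor (k := k) (S := S) hBA hK
  have := hBA.finite_left (k := k) hX
  have := finite_hom (k := k) (R := R) (T := T) (X := X)
  have : Module.Finite Sᵐᵒᵖ (Dual k (X →ₗ[Rᵐᵒᵖ] T)) := Module.Finite.of_restrictScalars_finite k _ _
  exact Module.Finite.equiv e

include hS hgen

theorem subsingleton_ext_map {G K : ModuleCat.{u} Sᵐᵒᵖ} (hG : A.map (homFunctor S R T) G)
    (hK : B.map (tensorFunctor R S (Dual k T)) K) : Subsingleton (Abelian.Ext G K 1) := by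
  obtain ⟨Y, hY, ⟨e⟩⟩ := hG
  obtain ⟨X, _, _, _, _, hX, ⟨e'⟩⟩ := exists_equiv_of_map_tensorFunctor (k := k) (S := S) hBA hK
  exact ((extVanishes_rightHom_dual (k := k) hS hBA hgen hX hY).congr_left
    (show RightHom R T Y ≃ₗ[Sᵐᵒᵖ] G from e.toLinearEquiv)).congr_right e'

/-- Dimension shift: Hom_R(T, Y') is a syzygy of Hom_R(T, Y) and again lies in G. This is what makes
the new pair hereditary. -/
theorem subsingleton_ext_two_map {G K : ModuleCat.{u} Sᵐᵒᵖ} (hG : A.map (homFunctor S R T) G)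
    (hK : B.map (tensorFunctor R S (Dual k T)) K) : Subsingleton (Abelian.Ext G K 2) := by
  obtain ⟨Y, hY, ⟨e⟩⟩ := hG
  obtain ⟨Y', T₀, _, _, _, _, ι, π, n, i, r, hY', hι, hex, hπ, hid⟩ := hgen.exists_exact hY
  have := projective_rightHom hS i r hid
  have := (IsProjective.iff_projective (R := Sᵐᵒᵖ) (RightHom R T T₀)).1 inferInstance
  refine subsingleton_ext_of_retract_left (Retract.ofIso e.symm) ?_
  exact subsingleton_ext_right (shortExact_of_exact (RightHom.map_injective (S := S) (V := T) hι)
    (RightHom.map_exact hι hex) (RightHom.map_surjective hι hex hπ (hgen.extProjective _ hY')))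
    (by norm_num) (subsingleton_ext_map hS hBA hgen ⟨ModuleCat.of _ Y', hY', ⟨Iso.refl _⟩⟩ hK)
    (Abelian.Ext.subsingleton_of_projective _ _ 1)

theorem map_homFunctor_of_subsingleton_ext {G : ModuleCat.{u} Sᵐᵒᵖ} [Module.Finite k S]
    [Module.Finite Sᵐᵒᵖ G]
    (h : ∀ K, B.map (tensorFunctor R S (Dual k T)) K → Subsingleton (Abelian.Ext G K 1)) :
    A.map (homFunctor S R T) G := by
  let := Module.restrictScalars k Sᵐᵒᵖ G
  have := IsScalarTower.restrictScalars k Sᵐᵒᵖ G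
  have : Module.Finite k G := Module.Finite.trans Sᵐᵒᵖ G
  have := isNoetherianRing_mulOpposite k R
  have hG : ∀ (X : Type u) [AddCommGroup X] [Module Rᵐᵒᵖ X], B (ModuleCat.of Rᵐᵒᵖ X) →
      ExtVanishes Sᵐᵒᵖ G (Dual k (X →ₗ[Rᵐᵒᵖ] T)) := by
    intro X _ _ hX
    let := Module.restrictScalars k Rᵐᵒᵖ X
    have := IsScalarTower.restrictScalars k Rᵐᵒᵖ X
    have := hBA.finite_left (k := k) hX
    have h1 : ExtVanishes Sᵐᵒᵖ G (BalancedTensor R S (Dual k T) X) :=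
      h _ ⟨ModuleCat.of _ X, hX, ⟨Iso.refl _⟩⟩
    exact h1.congr_right (LinearEquiv.ofBijective _ tensorDualMap_bijective)
  have hunit := unit_bijective_of_extVanishes hBA hgen.mem hG hS
    (mem_left_of_extProjective hBA hgen)
  have := BalancedTensor.finite (k := k) (S := S) (R := R) (V := T) (M := G)
  refine ⟨ModuleCat.of Rᵐᵒᵖ (BalancedTensor S R T G), ?_,
    ⟨(LinearEquiv.ofBijective _ hunit).symm.toModuleIso⟩⟩
  exact (hBA.isCotorsionPair.right_iff _).2 ⟨Module.Finite.of_restrictScalars_finite k Rᵐᵒᵖ _,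
    fun X hX => extVanishes_tensor (X := X) hBA hgen.mem hG hX⟩

theorem map_tensorFunctor_of_subsingleton_ext {K : ModuleCat.{u} Sᵐᵒᵖ} [Module.Finite k S]
    [Module.Finite Sᵐᵒᵖ K]
    (h : ∀ G, A.map (homFunctor S R T) G → Subsingleton (Abelian.Ext G K 1)) :
    B.map (tensorFunctor R S (Dual k T)) K := by
  let := Module.restrictScalars k Sᵐᵒᵖ K
  have := IsScalarTower.restrictScalars k Sᵐᵒᵖ K
  have : Module.Finite k K := Module.Finite.trans Sᵐᵒᵖ K
  -- Writing K = DL with L = DK brings in the results on left S-modules; the preimage in B is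
  -- Hom_S(DK, T).
  let e : K ≃ₗ[Sᵐᵒᵖ] Dual k (Dual k K) := LinearEquiv.ofBijective
    { toFun := Dual.eval k K
      map_add' := map_add _
      map_smul' := fun s x => Dual.ext fun φ => rfl } (Dual.eval_bijective K)
  have hT : ∀ (Y : Type u) [AddCommGroup Y] [Module Rᵐᵒᵖ Y], A (ModuleCat.of Rᵐᵒᵖ Y) →
      ExtVanishes Rᵐᵒᵖ T Y := fun Y _ _ hY => hgen.extProjective _ hY
  have hL : ∀ (Y : Type u) [AddCommGroup Y] [Module Rᵐᵒᵖ Y], A (ModuleCat.of Rᵐᵒᵖ Y) →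
      ExtVanishes Sᵐᵒᵖ (RightHom R T Y) (Dual k (Dual k K)) := fun Y _ _ hY =>
    ExtVanishes.congr_right e (h _ ⟨ModuleCat.of _ Y, hY, ⟨Iso.refl _⟩⟩)
  have hfin : Module.Finite k (Dual k K →ₗ[S] T) :=
    Module.Finite.of_injective (LinearMap.restrictScalarsₗ k S (Dual k K) T k)
      (LinearMap.restrictScalars_injective k)
  have hev := leftEval_bijective hBA hT hL hS hgen.mem
  let e' : Dual k ((Dual k K →ₗ[S] T) →ₗ[Rᵐᵒᵖ] T) ≃ₗ[Sᵐᵒᵖ] Dual k (Dual k K) :=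
    LinearEquiv.ofBijective (Dual.rightMap k (leftEval S R T (Dual k K)))
      ⟨Dual.map_injective (f := (leftEval S R T (Dual k K)).restrictScalars k) hev.2,
        Dual.map_surjective (f := (leftEval S R T (Dual k K)).restrictScalars k) hev.1⟩
  refine ⟨ModuleCat.of Rᵐᵒᵖ (Dual k K →ₗ[S] T), ?_,
    ⟨(((LinearEquiv.ofBijective _ (tensorDualMap_bijective (k := k) (S := S))).trans e').trans
      e.symm).toModuleIso⟩⟩
  refine (hBA.isCotorsionPair.left_iff _).2 ⟨Module.Finite.of_restrictScalars_finite k Rᵐᵒᵖ _,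
    fun Y hY => ?_⟩
  let := Module.restrictScalars k Rᵐᵒᵖ Y
  have := IsScalarTower.restrictScalars k Rᵐᵒᵖ Y
  exact extVanishes_leftHom (Y := Y) hBA hT hL hY

theorem isCotorsionPair_map [Module.Finite k S] :
    IsCotorsionPair (A.map (homFunctor S R T)) (B.map (tensorFunctor R S (Dual k T))) where
  left_iff _ := ⟨fun hG => ⟨finite_of_map_homFunctor (k := k) hBA hG,
      fun _ hK => subsingleton_ext_map hS hBA hgen hG hK⟩,
    fun ⟨_, hG⟩ => map_homFunctor_of_subsingleton_ext (k := k) hS hBA hgen hG⟩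
  right_iff _ := ⟨fun hK => ⟨finite_of_map_tensorFunctor hBA hK,
      fun _ hG => subsingleton_ext_map hS hBA hgen hG hK⟩,
    fun ⟨_, hK⟩ => map_tensorFunctor_of_subsingleton_ext hS hBA hgen hK⟩

theorem isHereditaryCotorsionPair_map [Module.Finite k S] :
    IsHereditaryCotorsionPair (A.map (homFunctor S R T)) (B.map (tensorFunctor R S (Dual k T))) := by
  have hcot := isCotorsionPair_map (k := k) hS hBA hgen
  have := isNoetherianRing_mulOpposite k S
  refine ⟨hcot, fun X hX => ((hcot.left_iff X).1 hX).1, fun X hX hproj =>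
    (hcot.left_iff X).2 ⟨hX, fun Y _ => extVanishes_of_projective (X := X) (Y := Y)⟩,
    ⟨fun {E} hE h₁ h₃ => ?_⟩, fun E hE hfin h₂ h₃ => ?_, ⟨fun {X Y} r hY => ?_⟩⟩
  · obtain ⟨_, hext₁⟩ := (hcot.left_iff _).1 h₁
    obtain ⟨_, hext₃⟩ := (hcot.left_iff _).1 h₃
    have hex := (ShortComplex.ShortExact.moduleCat_exact_iff_function_exact _).1 hE.exact
    have := isNoetherian_of_range_eq_ker E.f.hom E.g.hom hex.linearMap_ker_eq.symm
    exact (hcot.left_iff _).2 ⟨inferInstance,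
      fun Y hY => subsingleton_ext_middle hE (hext₁ Y hY) (hext₃ Y hY)⟩
  -- Ext¹ of the kernel sits between Ext¹ of the middle term and Ext² of the quotient.
  · exact (hcot.left_iff _).2 ⟨hfin, fun Y hY => subsingleton_ext_left hE (m := 2) (by norm_num)
      (subsingleton_ext_map hS hBA hgen h₂ hY) (subsingleton_ext_two_map hS hBA hgen h₃ hY)⟩
  · obtain ⟨_, hext⟩ := (hcot.left_iff _).1 hY
    exact (hcot.left_iff _).2 ⟨Module.Finite.of_surjective r.r.hom fun x =>
      ⟨r.i.hom x, congrArg (fun q => q.hom x) r.retract⟩,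
      fun Z hZ => subsingleton_ext_of_retract_left r (hext Z hZ)⟩

theorem representCounterEquivalence_map [Module.Finite k S] :
    RepresentCounterEquivalence S R T (Dual k T) B A (A.map (homFunctor S R T))
      (B.map (tensorFunctor R S (Dual k T))) where
  isCotorsionPair_left := hBA.isCotorsionPair
  isCotorsionPair_right := isCotorsionPair_map hS hBA hgen
  equivalence_left := by
    have := hBA.isCotorsionPair.isClosedUnderIsomorphisms_right
    refine restrictToEquivalence_of_isIso_counit (tensorHomAdjunction S R T) A fun Y hY => ?_
    let := Module.restrictScalars k Rᵐᵒᵖ Y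
    have := IsScalarTower.restrictScalars k Rᵐᵒᵖ Y
    exact (LinearEquiv.ofBijective _
      (lift_id_bijective (k := k) (Y := Y) hS hBA hgen hY)).toModuleIso.isIso_hom
  equivalence_right := by
    have := hBA.isCotorsionPair.isClosedUnderIsomorphisms_left
    refine restrictToEquivalence_of_isIso_unit (tensorHomAdjunction R S (Dual k T)) B
      fun X hX => ?_
    let := Module.restrictScalars k Rᵐᵒᵖ X
    have := IsScalarTower.restrictScalars k Rᵐᵒᵖ X
    have := hBA.finite_left (k := k) hX
    exact (LinearEquiv.ofBijective _ (unit_dual_bijective (k := k) (S := S) (X := X)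
      (fun _ hx => exists_hom_apply_ne_zero (k := k) hBA hgen hX hx)
      (exists_eval_eq (k := k) hS hBA hgen hX))).toModuleIso.isIso_hom

end Main

end CounterEquivalence

theorem mainTheorem3 {k R S T : Type u} [CommRing k] [IsArtinianRing k]
    [Ring R] [Algebra k R] [Module.Finite k R] [Ring S] [Algebra k S]
    [AddCommGroup T] [Module k T] [Module S T] [Module Rᵐᵒᵖ T]
    [IsScalarTower k S T] [IsScalarTower k Rᵐᵒᵖ T]
    [SMulCommClass S Rᵐᵒᵖ T]
    (hT : CounterEquivalence.IsWakamatsuTilting S R T)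
    (B A : ObjectProperty (ModuleCat.{u} Rᵐᵒᵖ))
    (hBA : CounterEquivalence.IsHereditaryCotorsionPair B A)
    (hgen : CounterEquivalence.IsExtProjectiveGenerator T A) :
    CounterEquivalence.IsHereditaryCotorsionPair
      (A.map (CounterEquivalence.homFunctor S R T))
      (B.map (CounterEquivalence.tensorFunctor R S (CounterEquivalence.Dual k T))) ∧
    CounterEquivalence.RepresentCounterEquivalence S R T (CounterEquivalence.Dual k T) B A
      (A.map (CounterEquivalence.homFunctor S R T))
      (B.map (CounterEquivalence.tensorFunctor R S (CounterEquivalence.Dual k T))) := by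
  have := hT.finite
  have : Module.Finite k T := Module.Finite.trans Rᵐᵒᵖ T
  have : Module.Finite k S := CounterEquivalence.finite_of_faithful (T := T) fun s hs =>
    (injective_iff_map_eq_zero _).1 hT.bijective_left.1 s (LinearMap.ext hs)
  exact ⟨CounterEquivalence.isHereditaryCotorsionPair_map hT.bijective_left hBA hgen,
    CounterEquivalence.representCounterEquivalence_map hT.bijective_left hBA hgen⟩
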